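/- Let $\mathcal H$ be a complex Hilbert space and $T$ an anti-unitary operator on $\mathcal H$ with $T^2=-\mathrm{Id}$. Let $\mathbb T^1=\mathbb R/2\pi\mathbb Z$ and $\mathbb T^2=\mathbb T^1\times\mathbb T^1$. A time-reversal symmetric projection-valued map of rank $r\in\mathbb N$ is a norm-continuous map $P$ from $\mathbb T^2$ to the orthogonal projections of rank $r$ on $\mathcal H$ such that $TP(k)=P(-k)T$ for all $k\in\mathbb T^2$. For such a $P$ of rank $2n$, the index $\delta(P)$ is defined as follows. Choose a norm-continuous map $U$ from $[-\pi,\pi]\times\mathbb T^1$ to the unitary operators on $\mathcal H$ with $P(t,k_2)U(t,k_2)=U(t,k_2)P(0,0)$ and $TU(t,k_2)=U(-t,-k_2)T$, and an orthonormal basis $u_1,\dots,u_{2n}$ of the range of $P(0,0)$ with $u_{n+j}=Tu_j$ for $1\le j\le n$. Define the matching matrices $\alpha(k_2)\in U(2n)$ by $U(-\pi,k_2)u_j=\sum_{a=1}^{2n}\alpha(k_2)_{j,a}\,U(\pi,k_2)u_a$. With $J=\begin{pmatrix}0&\mathbf 1_n\\-\mathbf 1_n&0\end{pmatrix}$, choose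 complex $2n\times 2n$ matrices $\gamma_0,\gamma_\pi$ with $\alpha(0)=J\gamma_0^{t}J^{-1}\gamma_0$ and $\alpha(\pi)=J\gamma_\pi^{t}J^{-1}\gamma_\pi$, real numbers $\lambda_0,\lambda_\pi$ with $\det\gamma_0=e^{i\lambda_0}$ and $\det\gamma_\pi=e^{i\lambda_\pi}$, and a continuous $\mu:[0,\pi]\to\mathbb R$ with $\det\alpha(k_2)=e^{i\mu(k_2)}$ for $k_2\in[0,\pi]$ and $\mu(0)=2\lambda_0$. Then $$\delta(P)=e^{i(2\lambda_\pi-\mu(\pi))/2}.$$ Lemma. Let $P$ and $Q$ be time-reversal symmetric projection-valued maps on $\mathbb T^2$ of ranks $2n$ and $2m$ respectively ($n,m\ge 0$), with $P(k)Q(k)=0$ for all $k\in\mathbb T^2$. Then $P+Q$ is a time-reversal symmetric projection-valued map of rank $2(n+m)$; for each of $P$, $Q$ and $P+Q$ the choices above exist and the resulting value $\delta$ does not depend on them; $\delta(P),\delta(Q)\in\{1,-1\}$; and $$\delta(P+Q)=\delta(P)\,\delta(Q).$$ -/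

import Mathlib

open scoped Real

noncomputable section

/-- The circle `ℝ / 2πℤ`. -/
abbrev Circ : Type := AddCircle (2 * π)

/-- The two-dimensional torus `(ℝ / 2πℤ)²`. -/
abbrev Torus2 : Type := Circ × Circ

/-- `T` is an anti-unitary operator (a conjugate-linear isometric bijection, by its type)
with `T² = -1`. -/
def IsFermionicTR {H : Type*} [NormedAddCommGroup H] [InnerProductSpace ℂ H]
    (T : H ≃ₗᵢ⋆[ℂ] H) : Prop :=
  ∀ x : H, T (T x) = -x

/-- `P` is a (norm-)continuous map from the two-torus to the orthogonal projections of rank `r` on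
the Hilbert space `H`, and `T P(k) = P(-k) T` for all `k`. The rank is read as a cardinal, so that
it is really finite. -/
structure IsTRSProjMap {H : Type*} [NormedAddCommGroup H] [InnerProductSpace ℂ H] [CompleteSpace H]
    (T : H ≃ₗᵢ⋆[ℂ] H) (r : ℕ) (P : Torus2 → H →L[ℂ] H) : Prop where
  continuous : Continuous P
  proj : ∀ k, IsStarProjection (P k)
  rank : ∀ k, Module.rank ℂ (LinearMap.range (P k : H →ₗ[ℂ] H)) = (r : Cardinal)
  symm : ∀ k x, T (P k x) = P (-k) (T x)

/-- The matrix `J = [[0, 1], [-1, 0]]` in blocks of size `n`. -/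
def quatJ (n : ℕ) : Matrix (Fin n ⊕ Fin n) (Fin n ⊕ Fin n) ℂ :=
  Matrix.fromBlocks 0 1 (-1) 0

/-- The family `u₁, …, uₙ, T u₁, …, T uₙ`. -/
def quatFamily {H : Type*} [NormedAddCommGroup H] [InnerProductSpace ℂ H]
    (T : H ≃ₗᵢ⋆[ℂ] H) {n : ℕ} (u : Fin n → H) : Fin n ⊕ Fin n → H :=
  Sum.elim u (fun j => T (u j))

/-- The choices that enter the definition of the `ℤ₂` index of a time-reversal symmetric
projection-valued map `P` of rank `2n`. Values of `U` at `t ∉ [-π, π]` and values of `μ` outside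
`[0, π]` play no role. -/
structure ParityData {H : Type*} [NormedAddCommGroup H] [InnerProductSpace ℂ H] [CompleteSpace H]
    (T : H ≃ₗᵢ⋆[ℂ] H) (P : Torus2 → H →L[ℂ] H) (n : ℕ) where
  /-- A unitary-valued map on `[-π, π] × 𝕋¹`, periodic in the second variable only. -/
  U : ℝ → Circ → unitary (H →L[ℂ] H)
  U_cont : ContinuousOn (fun p : ℝ × Circ => U p.1 p.2) (Set.Icc (-π) π ×ˢ Set.univ)
  U_intertwines : ∀ t ∈ Set.Icc (-π) π, ∀ k : Circ,
    P ((t : Circ), k) ∘L (U t k : H →L[ℂ] H) = (U t k : H →L[ℂ] H) ∘L P (0, 0)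
  U_symm : ∀ t ∈ Set.Icc (-π) π, ∀ (k : Circ) (x : H),
    T ((U t k : H →L[ℂ] H) x) = (U (-t) (-k) : H →L[ℂ] H) (T x)
  /-- A quaternionic orthonormal basis `u₁, …, uₙ, T u₁, …, T uₙ` of the range of `P(0,0)`. -/
  u : Fin n → H
  u_orthonormal : Orthonormal ℂ (quatFamily T u)
  u_span : Submodule.span ℂ (Set.range (quatFamily T u)) =
    LinearMap.range (P (0, 0) : H →ₗ[ℂ] H)
  /-- The matching matrices: `u_j(-π, k) = ∑ₐ α(k)_{j,a} u_a(π, k)` for `u_j(t, k) = U(t, k) u_j`. -/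
  α : Circ → Matrix (Fin n ⊕ Fin n) (Fin n ⊕ Fin n) ℂ
  α_matching : ∀ (k : Circ) (j : Fin n ⊕ Fin n),
    (U (-π) k : H →L[ℂ] H) (quatFamily T u j) =
      ∑ a, α k j a • (U π k : H →L[ℂ] H) (quatFamily T u a)
  γ₀ : Matrix (Fin n ⊕ Fin n) (Fin n ⊕ Fin n) ℂ
  γπ : Matrix (Fin n ⊕ Fin n) (Fin n ⊕ Fin n) ℂ
  γ₀_spec : α ((0 : ℝ) : Circ) = quatJ n * γ₀.transpose * (quatJ n)⁻¹ * γ₀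
  γπ_spec : α ((π : ℝ) : Circ) = quatJ n * γπ.transpose * (quatJ n)⁻¹ * γπ
  l₀ : ℝ
  lπ : ℝ
  l₀_spec : γ₀.det = Complex.exp (Complex.I * (l₀ : ℂ))
  lπ_spec : γπ.det = Complex.exp (Complex.I * (lπ : ℂ))
  /-- A continuous argument of `det α` on `[0, π]` starting at `2 l₀`. -/
  μ : ℝ → ℝ
  μ_cont : ContinuousOn μ (Set.Icc 0 π)
  μ_spec : ∀ k ∈ Set.Icc (0 : ℝ) π,
    (α (k : Circ)).det = Complex.exp (Complex.I * (μ k : ℂ))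
  μ_zero : μ 0 = 2 * l₀

/-- The number `exp(i (2 λ_π - μ(π)) / 2)` computed from a set of choices. -/
def ParityData.value {H : Type*} [NormedAddCommGroup H] [InnerProductSpace ℂ H] [CompleteSpace H]
    {T : H ≃ₗᵢ⋆[ℂ] H} {P : Torus2 → H →L[ℂ] H} {n : ℕ} (D : ParityData T P n) : ℂ :=
  Complex.exp (Complex.I * (((2 * D.lπ - D.μ π) / 2 : ℝ) : ℂ))

/-- `z` is the value of the `ℤ₂` index of `P` for some admissible choices. -/
def IsParityIndex {H : Type*} [NormedAddCommGroup H] [InnerProductSpace ℂ H] [CompleteSpace H]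
    (T : H ≃ₗᵢ⋆[ℂ] H) (P : Torus2 → H →L[ℂ] H) (z : ℂ) : Prop :=
  ∃ (n : ℕ) (D : ParityData T P n), D.value = z

/-- The `ℤ₂` index `δ(P)`: the value of `exp(i (2 λ_π - μ(π)) / 2)` for admissible choices. -/
def parityIndex {H : Type*} [NormedAddCommGroup H] [InnerProductSpace ℂ H] [CompleteSpace H]
    (T : H ≃ₗᵢ⋆[ℂ] H) (P : Torus2 → H →L[ℂ] H) : ℂ :=
  Classical.epsilon (IsParityIndex T P)

end

/-! Existence of choices. Nearby projections are intertwined by the Sz.-Nagy unitary, and composing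
short steps transports `P` along paths. First `k₂` runs from `0` to `π` at `t = 0`. To make the
transport unitary at `π` commute with `T`, it is multiplied by a square root of its defect; the
defect is identity plus finite rank, so its logarithm is a polynomial in it and has the required
symmetry (`exists_path_correction`). Reflection by `T` then closes the circle, and transport in `t`
followed by reflection fills the cylinder (`IsTRSProjMap.exists_unitary`). The matrices `γ` are
polynomial square roots of `α` (`exists_quatJ_factorization`).

Independence. Two symmetric frames differ by a unitary matrix `G(t, k)` with `J G(-t, -k) =
conj(G(t, k)) J`. At a fixed point of `k ↦ -k`, the factor `γ` is unique up to a symplectic matrix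
on the left, so `det γ` is determined by `α`, and changing frame divides it by `det G(π, k)`. In the
exponent of `δ`, all changes are multiples of `2π` except half the variation of `arg det G(π, ·)`
around the circle. Moving `t` from `π` to `0` preserves that winding number. At `t = 0` the loop
satisfies `det G(0, -k) = conj(det G(0, k))` and equals `1` at `k = 0, π`, since `G` is symplectic
there; hence the winding is even (`exp_half_winding_eq_one`, `ParityData.value_eq`).

The values are signs because `det α(π) = (det γπ)²`. Multiplicativity follows by taking direct sums
of all choices, with the unitaries glued along `P`, `Q` and the complement
(`exists_parityData_add`): determinants multiply and arguments add. -/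

noncomputable section

/-! ### Matrix algebra of the quaternionic structure. -/

lemma quatJ_eq_neg_J (n : ℕ) : quatJ n = -Matrix.J (Fin n) ℂ := by
  simp [quatJ, Matrix.J, Matrix.fromBlocks_neg]

lemma quatJ_mul_self (n : ℕ) : quatJ n * quatJ n = -1 := by
  simp [quatJ_eq_neg_J, Matrix.J_squared]

lemma quatJ_inv (n : ℕ) : (quatJ n)⁻¹ = -quatJ n :=
  Matrix.inv_eq_right_inv (by simp [quatJ_mul_self])

lemma quatJ_mul_inv (n : ℕ) : quatJ n * (quatJ n)⁻¹ = 1 := by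
  simp [quatJ_inv, quatJ_mul_self]

lemma quatJ_inv_mul (n : ℕ) : (quatJ n)⁻¹ * quatJ n = 1 := by
  simp [quatJ_inv, quatJ_mul_self]

lemma quatJ_det_ne_zero (n : ℕ) : (quatJ n).det ≠ 0 := by
  intro h
  have := congrArg Matrix.det (quatJ_mul_inv n)
  simp [h] at this

lemma det_eq_one_of_transpose_mul_quatJ_mul {n : ℕ} {S : Matrix (Fin n ⊕ Fin n) (Fin n ⊕ Fin n) ℂ}
    (h : S.transpose * quatJ n * S = quatJ n) : S.det = 1 := by
  apply SymplecticGroup.det_eq_one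
  rw [SymplecticGroup.mem_iff']
  simpa [quatJ_eq_neg_J] using h

/-- Both factorizations give the same form `gᵗ J g`, so `g' g⁻¹` is symplectic and has determinant
one. This is why `det γ` depends on `α` alone although `γ` does not. -/
lemma det_eq_det_of_quatJ_congr {n : ℕ} {g g' : Matrix (Fin n ⊕ Fin n) (Fin n ⊕ Fin n) ℂ}
    (hg : g.det ≠ 0)
    (h : quatJ n * g'.transpose * (quatJ n)⁻¹ * g' = quatJ n * g.transpose * (quatJ n)⁻¹ * g) :
    g'.det = g.det := by
  have hu : IsUnit g.det := isUnit_iff_ne_zero.mpr hg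
  have h1 : g'.transpose * quatJ n * g' = g.transpose * quatJ n * g := by
    have := congrArg (quatJ n * ·) h
    simpa [quatJ_inv, ← mul_assoc, quatJ_mul_self] using this
  have h2 : (g' * g⁻¹).det = 1 := by
    apply det_eq_one_of_transpose_mul_quatJ_mul
    rw [Matrix.transpose_mul, Matrix.transpose_nonsing_inv]
    calc _ = g.transpose⁻¹ * (g'.transpose * quatJ n * g') * g⁻¹ := by simp only [mul_assoc]
      _ = (g.transpose⁻¹ * g.transpose) * quatJ n * (g * g⁻¹) := by rw [h1]; simp only [mul_assoc]
      _ = quatJ n := by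
        rw [Matrix.mul_nonsing_inv _ hu, Matrix.nonsing_inv_mul _ (by simpa using hu)]; simp
  rw [Matrix.det_mul, Matrix.det_nonsing_inv] at h2
  rw [Ring.inverse_eq_inv'] at h2
  field_simp at h2
  exact h2

lemma transpose_mul_map_star {ι : Type*} [Fintype ι] [DecidableEq ι] {g : Matrix ι ι ℂ}
    (hu : g * g.conjTranspose = 1) : g.transpose * g.map (starRingEnd ℂ) = 1 := by
  have h3 := congrArg Matrix.transpose (mul_eq_one_comm.mp hu)
  have h4 : g.conjTranspose.transpose = g.map (starRingEnd ℂ) := by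
    ext i j; simp [Matrix.conjTranspose_apply]
  rwa [Matrix.transpose_mul, h4, Matrix.transpose_one] at h3

/-- A unitary matrix commuting with the quaternionic structure has determinant one. -/
lemma det_eq_one_of_quatJ_mul_eq {n : ℕ} {g : Matrix (Fin n ⊕ Fin n) (Fin n ⊕ Fin n) ℂ}
    (hu : g * g.conjTranspose = 1) (h : quatJ n * g = g.map (starRingEnd ℂ) * quatJ n) :
    g.det = 1 := by
  apply det_eq_one_of_transpose_mul_quatJ_mul
  rw [mul_assoc, h, ← mul_assoc, transpose_mul_map_star hu, one_mul]

/-! ### Functional calculus on a finite spectrum. -/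

section FiniteSpectrum

variable {A : Type*} [CStarAlgebra A]

-- Lagrange interpolation on the spectrum. Polynomials in `a` inherit the algebraic symmetries of
-- `a`, which is what the square root and the logarithm need later.
open Polynomial in
lemma exists_polynomial_cfc_eq (f : ℂ → ℂ) (a : A) [IsStarNormal a] (ha : (spectrum ℂ a).Finite) :
    ∃ p : ℂ[X], cfc f a = aeval a p := by
  refine ⟨Lagrange.interpolate ha.toFinset id f, ?_⟩
  rw [← cfc_polynomial _ a]
  refine cfc_congr fun z hz => ?_
  have := Lagrange.eval_interpolate_at_node (r := f) (v := id) (s := ha.toFinset)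
    (Set.injOn_id _) (ha.mem_toFinset.mpr hz)
  simpa using this.symm

/-- A unitary element with finite spectrum is the exponential of `I` times a self-adjoint element,
which can be chosen to be a polynomial in it. -/
lemma exists_expUnitary_eq_of_finite_spectrum (a : unitary A)
    (ha : (spectrum ℂ (a : A)).Finite) :
    ∃ (b : selfAdjoint A) (p : Polynomial ℂ), selfAdjoint.expUnitary b = a ∧
      (b : A) = Polynomial.aeval (a : A) p := by
  have hn : IsStarNormal (a : A) := inferInstance
  -- The branch cut of `Complex.arg` is harmless: every function is continuous on a finite set.
  have hc : ∀ f : ℂ → ℂ, ContinuousOn f (spectrum ℂ (a : A)) := fun f => ha.continuousOn f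
  obtain ⟨p, hp⟩ := exists_polynomial_cfc_eq (fun z => (Complex.arg z : ℂ)) (a : A) ha
  refine ⟨Unitary.argSelfAdjoint a, p, ?_, hp⟩
  ext
  rw [selfAdjoint.expUnitary_coe, Unitary.argSelfAdjoint_coe,
    ← CFC.exp_eq_normedSpace_exp (𝕜 := ℂ), ← cfc_comp_smul .., ← cfc_comp' (hf := hc _) ..]
  conv_rhs => rw [← cfc_id' ℂ (a : A)]
  refine cfc_congr fun y hy ↦ ?_
  have hy₁ : ‖y‖ = 1 := spectrum.norm_eq_one_of_unitary a.2 hy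
  have := Complex.norm_mul_exp_arg_mul_I y
  rw [hy₁] at this
  simpa [← Complex.exp_eq_exp_ℂ, mul_comm] using this

end FiniteSpectrum

open scoped Matrix.Norms.L2Operator in
/-- Every matrix `α ∈ U(2n)` with `J αᵗ J⁻¹ = α` can be written as `J γᵗ J⁻¹ γ`. -/
lemma exists_quatJ_factorization {n : ℕ} {a : Matrix (Fin n ⊕ Fin n) (Fin n ⊕ Fin n) ℂ}
    (hu : a * a.conjTranspose = 1) (h : quatJ n * a.transpose * (quatJ n)⁻¹ = a) :
    ∃ g : Matrix (Fin n ⊕ Fin n) (Fin n ⊕ Fin n) ℂ,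
      a = quatJ n * g.transpose * (quatJ n)⁻¹ * g := by
  have hn : IsStarNormal a := ⟨by
    rw [Matrix.star_eq_conjTranspose]
    exact (mul_eq_one_comm.mp hu).trans hu.symm⟩
  have hf : (spectrum ℂ a).Finite := Matrix.finite_spectrum a
  have hc : ∀ f : ℂ → ℂ, ContinuousOn f (spectrum ℂ a) := fun f => hf.continuousOn f
  obtain ⟨p, hp⟩ := exists_polynomial_cfc_eq (fun z => z ^ (1 / 2 : ℂ)) a hf
  have hsq : Polynomial.aeval a p * Polynomial.aeval a p = a := by
    rw [← hp, ← cfc_mul _ _ _ (hc _) (hc _)]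
    conv_rhs => rw [← cfc_id' ℂ a]
    refine cfc_congr fun y hy ↦ ?_
    rw [← sq, ← Complex.cpow_nat_mul]
    simp
  -- The map `X ↦ J Xᵗ J⁻¹` is a linear anti-automorphism fixing `a`, hence fixes each polynomial in
  -- `a`. Applied to the square root `γ` of `a`, it gives `J γᵗ J⁻¹ γ = γ² = a`.
  have hconj : ∀ q : Polynomial ℂ,
      quatJ n * (Polynomial.aeval a q).transpose * (quatJ n)⁻¹ = Polynomial.aeval a q := by
    intro q
    induction q using Polynomial.induction_on with
    | C c =>
      rw [Polynomial.aeval_C, Algebra.algebraMap_eq_smul_one, Matrix.transpose_smul,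
        Matrix.transpose_one]
      simp [quatJ_mul_inv]
    | add p q hp hq =>
      rw [map_add, Matrix.transpose_add, mul_add, add_mul, hp, hq]
    | monomial k c hk =>
      have : (Polynomial.C c * Polynomial.X ^ (k + 1) : Polynomial ℂ)
        = (Polynomial.C c * Polynomial.X ^ k) * Polynomial.X := by rw [pow_succ, mul_assoc]
      rw [this, map_mul, Polynomial.aeval_X, Matrix.transpose_mul]
      have hcomm : a * Polynomial.aeval a (Polynomial.C c * Polynomial.X ^ k)
          = Polynomial.aeval a (Polynomial.C c * Polynomial.X ^ k) * a := by
        have := (Commute.all Polynomial.X (Polynomial.C c * Polynomial.X ^ k)).map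
          (Polynomial.aeval (R := ℂ) a)
        rw [Polynomial.aeval_X] at this
        exact this.eq
      set b := Polynomial.aeval a (Polynomial.C c * Polynomial.X ^ k)
      calc quatJ n * (a.transpose * b.transpose) * (quatJ n)⁻¹
          = (quatJ n * a.transpose * (quatJ n)⁻¹) * (quatJ n * b.transpose * (quatJ n)⁻¹) := by
            have : ∀ x y : Matrix (Fin n ⊕ Fin n) (Fin n ⊕ Fin n) ℂ,
              x * (quatJ n)⁻¹ * (quatJ n * y) = x * y := fun x y => by
                rw [mul_assoc, ← mul_assoc _ (quatJ n), quatJ_inv_mul, one_mul]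
            rw [mul_assoc (quatJ n) b.transpose, this]
            simp only [mul_assoc]
        _ = b * a := by rw [h, hk, hcomm]
  exact ⟨Polynomial.aeval a p, by rw [hconj, hsq]⟩

/-! ### The Sz.-Nagy unitary between two close projections. -/

section Nagy

variable {A : Type*} [CStarAlgebra A]

/-- The (unnormalised) intertwiner of two projections. -/
def preIntertwiner (p q : A) : A := q * p + (1 - q) * (1 - p)

/-- The unitary of Sz.-Nagy intertwining two projections at distance less than one. -/
def nagyUnitary [PartialOrder A] [StarOrderedRing A] (p q : A) : A :=
  preIntertwiner p q * (1 - (p - q) ^ 2) ^ (-(1 / 2) : ℝ)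

variable {p q : A}

lemma preIntertwiner_mul_left (hp : IsStarProjection p) (hq : IsStarProjection q) :
    preIntertwiner p q * p = q * preIntertwiner p q := by
  have h1 := hp.isIdempotentElem.eq
  have h2 := hq.isIdempotentElem.eq
  simp only [preIntertwiner]
  simp only [mul_sub, sub_mul, mul_add, add_mul, mul_one, one_mul, ← mul_assoc, h2]
  simp only [mul_assoc, h1]
  abel

lemma star_preIntertwiner (hp : IsStarProjection p) (hq : IsStarProjection q) :
    star (preIntertwiner p q) = preIntertwiner q p := by
  simp [preIntertwiner, hp.isSelfAdjoint.star_eq, hq.isSelfAdjoint.star_eq]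

lemma preIntertwiner_mul_preIntertwiner (hp : IsStarProjection p) (hq : IsStarProjection q) :
    preIntertwiner q p * preIntertwiner p q = 1 - (p - q) ^ 2 := by
  have h1 := hp.isIdempotentElem.eq
  have h2 := hq.isIdempotentElem.eq
  have h3 : ∀ x, q * (q * x) = q * x := fun x => by rw [← mul_assoc, h2]
  simp only [preIntertwiner, sq]
  simp only [mul_sub, sub_mul, mul_add, add_mul, mul_one, one_mul, mul_assoc, h2, h1, h3]
  abel

lemma preIntertwiner_mul_preIntertwiner' (hp : IsStarProjection p) (hq : IsStarProjection q) :
    preIntertwiner p q * preIntertwiner q p = 1 - (p - q) ^ 2 := by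
  rw [preIntertwiner_mul_preIntertwiner hq hp, ← neg_sub q p, neg_sq]

/-- Both `p (p - q)²` and `(p - q)² p` equal `p - p q p`. Normalising by a power of `1 - (p - q)²`
therefore keeps the intertwining relation. -/
lemma commute_one_sub_sq (hp : IsStarProjection p) (hq : IsStarProjection q) :
    Commute (1 - (p - q) ^ 2) p := by
  have h1 := hp.isIdempotentElem.eq
  have h2 := hq.isIdempotentElem.eq
  have h3 : ∀ x, p * (p * x) = p * x := fun x => by rw [← mul_assoc, h1]
  simp only [Commute, SemiconjBy, sq]
  simp only [mul_sub, sub_mul, mul_one, one_mul, mul_assoc, h2, h1, h3]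
  abel

lemma commute_one_sub_sq' (hp : IsStarProjection p) (hq : IsStarProjection q) :
    Commute (1 - (p - q) ^ 2) q := by
  have := commute_one_sub_sq hq hp
  rwa [← neg_sub q p, neg_sq]

variable [PartialOrder A] [StarOrderedRing A]

lemma isStrictlyPositive_one_sub_sq (hp : IsStarProjection p) (hq : IsStarProjection q)
    (h : ‖p - q‖ < 1) : IsStrictlyPositive (1 - (p - q) ^ 2) := by
  refine ⟨?_, ?_⟩
  · rw [← preIntertwiner_mul_preIntertwiner hp hq, ← star_preIntertwiner hp hq]
    exact star_mul_self_nonneg _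
  · apply isUnit_one_sub_of_norm_lt_one
    calc ‖(p - q) ^ 2‖ ≤ ‖p - q‖ ^ 2 := by rw [sq, sq]; exact norm_mul_le _ _
      _ < 1 := by nlinarith [norm_nonneg (p - q)]

lemma rpow_mul_rpow_mul {c : A} (hc : IsStrictlyPositive c) :
    c ^ (-(1 / 2) : ℝ) * c ^ (-(1 / 2) : ℝ) * c = 1 := by
  have h0 : (0 : A) ≤ c := hc.nonneg
  conv_lhs => rw [← CFC.rpow_add hc.isUnit]; arg 2; rw [← CFC.rpow_one c]
  rw [← CFC.rpow_add hc.isUnit]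
  norm_num
  exact CFC.rpow_zero c

lemma commute_rpow {c b : A} (h : Commute c b) (r : ℝ) : Commute (c ^ r) b :=
  h.cfc_nnreal _

lemma nagyUnitary_mem_unitary (hp : IsStarProjection p) (hq : IsStarProjection q)
    (h : ‖p - q‖ < 1) : nagyUnitary p q ∈ unitary A := by
  have hc := isStrictlyPositive_one_sub_sq hp hq h
  have hR := rpow_mul_rpow_mul hc
  have hcp := commute_rpow (commute_one_sub_sq hp hq) (-(1 / 2) : ℝ)
  have hcq := commute_rpow (commute_one_sub_sq' hp hq) (-(1 / 2) : ℝ)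
  have hcc := commute_rpow (Commute.refl (1 - (p - q) ^ 2)) (-(1 / 2) : ℝ)
  have hsa : star ((1 - (p - q) ^ 2) ^ (-(1 / 2) : ℝ)) = (1 - (p - q) ^ 2) ^ (-(1 / 2) : ℝ) :=
    (IsSelfAdjoint.of_nonneg CFC.rpow_nonneg).star_eq
  have hX : Commute ((1 - (p - q) ^ 2) ^ (-(1 / 2) : ℝ)) (preIntertwiner p q) :=
    (hcq.mul_right hcp).add_right
      (((Commute.one_right _).sub_right hcq).mul_right ((Commute.one_right _).sub_right hcp))
  have e1 := preIntertwiner_mul_preIntertwiner hp hq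
  have e2 := preIntertwiner_mul_preIntertwiner' hp hq
  rw [Unitary.mem_iff]
  simp only [nagyUnitary, star_mul, hsa, star_preIntertwiner hp hq]
  set R := (1 - (p - q) ^ 2) ^ (-(1 / 2) : ℝ)
  set c := 1 - (p - q) ^ 2
  constructor
  · calc _ = R * (preIntertwiner q p * preIntertwiner p q) * R := by simp only [mul_assoc]
      _ = 1 := by rw [e1, mul_assoc, ← hcc.eq, ← mul_assoc, hR]
  · calc _ = (preIntertwiner p q * R) * (R * preIntertwiner q p) := by simp only [mul_assoc]
      _ = R * (preIntertwiner p q * R) * preIntertwiner q p := by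
        rw [show preIntertwiner p q * R * (R * preIntertwiner q p)
          = (preIntertwiner p q * R) * R * preIntertwiner q p by simp only [mul_assoc], ← hX.eq,
          mul_assoc R, hX.eq]
      _ = R * R * (preIntertwiner p q * preIntertwiner q p) := by
        rw [← hX.eq]; simp only [mul_assoc]
      _ = 1 := by rw [e2, hR]

lemma nagyUnitary_mul (hp : IsStarProjection p) (hq : IsStarProjection q) :
    nagyUnitary p q * p = q * nagyUnitary p q := by
  rw [nagyUnitary, mul_assoc, (commute_rpow (commute_one_sub_sq hp hq) _).eq, ← mul_assoc,
    preIntertwiner_mul_left hp hq, mul_assoc]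

lemma nagyUnitary_self (hp : IsStarProjection p) : nagyUnitary p p = 1 := by
  have h1 := hp.isIdempotentElem.eq
  simp only [nagyUnitary, preIntertwiner, sub_self, zero_pow two_ne_zero, sub_zero, CFC.one_rpow,
    mul_one, mul_sub, sub_mul, one_mul, h1]
  abel

/-- With `R` the normalising factor, `(R + 1)(R - 1) = R² (p - q)²` lies in `I` and `R + 1` is
invertible, so `R - 1 ∈ I`. For finite-rank projections the unitary is thus identity plus finite
rank. -/
lemma nagyUnitary_sub_one_mem (hp : IsStarProjection p) (hq : IsStarProjection q)
    (h : ‖p - q‖ < 1) (I : Ideal A) (hpI : p ∈ I) (hqI : q ∈ I) : nagyUnitary p q - 1 ∈ I := by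
  have hc := isStrictlyPositive_one_sub_sq hp hq h
  have hR := rpow_mul_rpow_mul hc
  rw [nagyUnitary]
  set R := (1 - (p - q) ^ 2) ^ (-(1 / 2) : ℝ) with hRdef
  have hR0 : 0 ≤ R := CFC.rpow_nonneg
  have hu : IsUnit (R + 1) := by
    have : IsStrictlyPositive (R + 1) :=
      IsStrictlyPositive.nonneg_add hR0 isStrictlyPositive_one
    exact this.isUnit
  have hpq : p - q ∈ I := I.sub_mem hpI hqI
  have h1 : R - 1 ∈ I := by
    obtain ⟨v, hv⟩ := hu
    have h2 : (R + 1) * (R - 1) = R * R * (p - q) * (p - q) := by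
      have : R * R * (1 - (p - q) ^ 2) = R * R - R * R * (p - q) * (p - q) := by
        rw [mul_sub, mul_one, sq, ← mul_assoc]
      rw [hR] at this
      have h3 : (R + 1) * (R - 1) = R * R - 1 := by
        simp only [mul_sub, add_mul, mul_one, one_mul]; abel
      rw [h3, this]; abel
    have h4 : R - 1 = (↑v⁻¹ : A) * (R * R * (p - q)) * (p - q) := by
      rw [mul_assoc, ← h2, ← hv, Units.inv_mul_cancel_left]
    rw [h4]
    exact I.mul_mem_left _ hpq
  have h2 : preIntertwiner p q - 1 ∈ I := by
    have : preIntertwiner p q - 1 = (2 * q - 1) * p - q := by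
      simp only [preIntertwiner, mul_sub, sub_mul, mul_one, one_mul, two_mul, add_mul]; abel
    rw [this]
    exact I.sub_mem (I.mul_mem_left _ hpI) hqI
  have : preIntertwiner p q * R - 1 = preIntertwiner p q * (R - 1) + (preIntertwiner p q - 1) := by
    rw [mul_sub, mul_one]; abel
  rw [this]
  exact I.add_mem (I.mul_mem_left _ h1) h2

lemma continuous_nagyUnitary {X : Type*} [TopologicalSpace X] {f g : X → A} (hf : Continuous f)
    (hg : Continuous g) (hfp : ∀ x, IsStarProjection (f x)) (hgp : ∀ x, IsStarProjection (g x))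
    (h : ∀ x, ‖f x - g x‖ < 1) : Continuous fun x => nagyUnitary (f x) (g x) := by
  unfold nagyUnitary preIntertwiner
  refine Continuous.mul (by fun_prop) ?_
  have hc : Continuous fun x => 1 - (f x - g x) ^ 2 := by fun_prop
  exact (CFC.continuousOn_rpow (A := A) (-(1 / 2) : ℝ)).comp_continuous hc
    (fun x => isStrictlyPositive_one_sub_sq (hfp x) (hgp x) (h x))

end Nagy

/-! ### Transport along paths of projections. -/

section Transport

variable {A : Type*} [CStarAlgebra A] [PartialOrder A] [StarOrderedRing A]

/-- Unitary transport along a path of projections depending on a parameter. -/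
lemma exists_transport_min {K : Type*} [TopologicalSpace K] {p : ℝ → K → A}
    (hc : Continuous fun x : ℝ × K => p x.1 x.2) (hp : ∀ t k, IsStarProjection (p t k))
    {δ : ℝ} (hδ0 : 0 < δ) (hδ : ∀ k s t, |s - t| ≤ δ → ‖p s k - p t k‖ < 1)
    (I : Ideal A) (hI : ∀ t k, p t k ∈ I) (N : ℕ) :
    ∃ V : ℝ → K → unitary A, (Continuous fun x : ℝ × K => V x.1 x.2) ∧ (∀ k, V 0 k = 1) ∧
      (∀ t k, p (min (max t 0) (N * δ)) k * (V t k : A) = (V t k : A) * p 0 k) ∧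
      ∀ t k, (V t k : A) - 1 ∈ I := by
  induction N with
  | zero => exact ⟨fun _ _ => 1, by fun_prop, by simp, by simp, by simp⟩
  | succ N ih =>
    obtain ⟨V, hV, hV0, hVp, hVI⟩ := ih
    have hd : ∀ t k, ‖p (min (max t 0) (N * δ)) k - p (min (max t 0) ((N + 1 : ℕ) * δ)) k‖ < 1 := by
      intro t k
      apply hδ
      refine (abs_min_sub_min_le_max _ _ _ _).trans ?_
      push_cast
      rw [sub_self, abs_zero, show (N : ℝ) * δ - (N + 1) * δ = -δ by ring, abs_neg,
        abs_of_pos hδ0, max_eq_right hδ0.le]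
    -- The new factor joins the two clamped times. It equals `1` while `t ≤ N * δ`, so a single
    -- formula serves all `t` and no pieces have to be patched.
    refine ⟨fun t k => ⟨nagyUnitary (p (min (max t 0) (N * δ)) k)
      (p (min (max t 0) ((N + 1 : ℕ) * δ)) k), nagyUnitary_mem_unitary (hp _ _) (hp _ _) (hd t k)⟩
      * V t k, ?_, ?_, ?_, ?_⟩
    · refine Continuous.mul (Continuous.subtype_mk ?_ _) hV
      refine continuous_nagyUnitary ?_ ?_ (fun _ => hp _ _) (fun _ => hp _ _) (fun x => hd x.1 x.2)
      · exact hc.comp (f := fun x : ℝ × K => (min (max x.1 0) (N * δ), x.2)) (by fun_prop)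
      · exact hc.comp (f := fun x : ℝ × K => (min (max x.1 0) ((N + 1 : ℕ) * δ), x.2))
          (by fun_prop)
    · intro k
      ext
      have h1 : min (max (0 : ℝ) 0) (N * δ) = 0 := by
        rw [max_self]; exact min_eq_left (by positivity)
      have h2 : min (max (0 : ℝ) 0) ((N + 1 : ℕ) * δ) = 0 := by
        rw [max_self]; exact min_eq_left (by positivity)
      simp only [hV0, h1, h2, nagyUnitary_self (hp _ _), mul_one, OneMemClass.coe_one]
    · intro t k
      simp only [Submonoid.coe_mul]
      rw [← mul_assoc, ← nagyUnitary_mul (hp _ _) (hp _ _), mul_assoc, hVp, mul_assoc]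
    · intro t k
      simp only [Submonoid.coe_mul]
      have := nagyUnitary_sub_one_mem (hp _ _) (hp _ _) (hd t k) I (hI _ _) (hI _ _)
      set n := nagyUnitary (p (min (max t 0) (N * δ)) k) (p (min (max t 0) ((N + 1 : ℕ) * δ)) k)
      have h : n * (V t k : A) - 1 = n * ((V t k : A) - 1) + (n - 1) := by
        rw [mul_sub, mul_one]; abel
      rw [h]
      exact I.add_mem (I.mul_mem_left _ (hVI t k)) this

lemma exists_transport {K : Type*} [TopologicalSpace K] {p : ℝ → K → A}
    (hc : Continuous fun x : ℝ × K => p x.1 x.2) (hp : ∀ t k, IsStarProjection (p t k))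
    {δ : ℝ} (hδ0 : 0 < δ) (hδ : ∀ k s t, |s - t| ≤ δ → ‖p s k - p t k‖ < 1)
    (I : Ideal A) (hI : ∀ t k, p t k ∈ I) (a : ℝ) :
    ∃ V : ℝ → K → unitary A, (Continuous fun x : ℝ × K => V x.1 x.2) ∧ (∀ k, V 0 k = 1) ∧
      (∀ t ∈ Set.Icc 0 a, ∀ k, p t k * (V t k : A) = (V t k : A) * p 0 k) ∧
      ∀ t k, (V t k : A) - 1 ∈ I := by
  obtain ⟨N, hN⟩ := exists_nat_ge (a / δ)
  obtain ⟨V, h1, h2, h3, h4⟩ := exists_transport_min hc hp hδ0 hδ I hI N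
  refine ⟨V, h1, h2, fun t ht k => ?_, h4⟩
  have := h3 t k
  rwa [max_eq_left ht.1, min_eq_left] at this
  rw [div_le_iff₀ hδ0] at hN
  exact ht.2.trans hN

end Transport

/-! ### Finite-rank perturbations of the identity. -/

section FiniteRank

variable {H : Type*} [NormedAddCommGroup H] [InnerProductSpace ℂ H]

variable (H) in
/-- The (left) ideal of operators of finite rank. -/
def finiteRankIdeal : Ideal (H →L[ℂ] H) where
  carrier := {F | FiniteDimensional ℂ (LinearMap.range (F : H →ₗ[ℂ] H))}
  add_mem' {a b} ha hb := by
    have ha' : FiniteDimensional ℂ (LinearMap.range (a : H →ₗ[ℂ] H)) := ha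
    have hb' : FiniteDimensional ℂ (LinearMap.range (b : H →ₗ[ℂ] H)) := hb
    refine Submodule.finiteDimensional_of_le (S₂ := LinearMap.range (a : H →ₗ[ℂ] H) ⊔
      LinearMap.range (b : H →ₗ[ℂ] H)) ?_
    rintro _ ⟨x, rfl⟩
    exact Submodule.add_mem_sup ⟨x, rfl⟩ ⟨x, rfl⟩
  zero_mem' := by
    have : LinearMap.range ((0 : H →L[ℂ] H) : H →ₗ[ℂ] H) = ⊥ := by
      simp
    simp only [Set.mem_ofPred_eq]
    rw [this]
    infer_instance
  smul_mem' c a ha := by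
    have ha' : FiniteDimensional ℂ (LinearMap.range (a : H →ₗ[ℂ] H)) := ha
    have : LinearMap.range ((c • a : H →L[ℂ] H) : H →ₗ[ℂ] H)
        = (LinearMap.range (a : H →ₗ[ℂ] H)).map (c : H →ₗ[ℂ] H) := by
      rw [← LinearMap.range_comp]; rfl
    simp only [Set.mem_ofPred_eq]
    rw [this]
    infer_instance

lemma mem_finiteRankIdeal {F : H →L[ℂ] H} :
    F ∈ finiteRankIdeal H ↔ FiniteDimensional ℂ (LinearMap.range (F : H →ₗ[ℂ] H)) := Iff.rfl

-- By Cayley–Hamilton, the characteristic polynomial of `F` restricted to its range kills that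
-- range; one more factor `X` first sends every vector into the range.
open Polynomial in
lemma exists_aeval_eq_zero_of_mem_finiteRankIdeal {F : H →L[ℂ] H} (hF : F ∈ finiteRankIdeal H) :
    ∃ q : ℂ[X], q ≠ 0 ∧ aeval F q = 0 := by
  rw [mem_finiteRankIdeal] at hF
  have hmap : ∀ x ∈ LinearMap.range (F : H →ₗ[ℂ] H), (F : H →ₗ[ℂ] H) x ∈
    LinearMap.range (F : H →ₗ[ℂ] H) := fun x _ => ⟨x, rfl⟩
  let f := (F : H →ₗ[ℂ] H).restrict hmap
  have key : ∀ (q : ℂ[X]) (w : LinearMap.range (F : H →ₗ[ℂ] H)),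
      aeval F q (w : H) = (aeval f q w : LinearMap.range (F : H →ₗ[ℂ] H)) := by
    intro q
    induction q using Polynomial.induction_on with
    | C c => intro w; simp [Algebra.algebraMap_eq_smul_one]
    | add p q hp hq => intro w; simp [hp, hq]
    | monomial k c hk =>
      intro w
      have : (C c * X ^ (k + 1) : ℂ[X]) = (C c * X ^ k) * X := by rw [pow_succ, mul_assoc]
      rw [this, map_mul _ (C c * X ^ k), map_mul _ (C c * X ^ k), aeval_X, aeval_X]
      exact hk (f w)
  refine ⟨f.charpoly * X, mul_ne_zero f.charpoly_monic.ne_zero X_ne_zero, ?_⟩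
  ext x
  rw [map_mul, aeval_X]
  have := key f.charpoly ⟨F x, x, rfl⟩
  rw [LinearMap.aeval_self_charpoly] at this
  simpa using this

open Polynomial in
lemma finite_spectrum_of_sub_one_mem {M : H →L[ℂ] H} (hM : M - 1 ∈ finiteRankIdeal H) :
    (spectrum ℂ M).Finite := by
  obtain ⟨q, hq, h0⟩ := exists_aeval_eq_zero_of_mem_finiteRankIdeal hM
  have h1 : (spectrum ℂ (M - 1)).Finite := by
    refine (q.rootSet_finite ℂ).subset fun z hz => ?_
    rw [mem_rootSet]
    refine ⟨hq, ?_⟩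
    have := spectrum.subset_polynomial_aeval (M - 1) q ⟨z, hz, rfl⟩
    rw [h0] at this
    rcases subsingleton_or_nontrivial (H →L[ℂ] H) with h | h
    · exact absurd this (by simp [spectrum.of_subsingleton])
    · simpa using this
  refine (h1.image (fun z => z + 1)).subset fun z hz => ⟨z - 1, ?_, by ring⟩
  have := spectrum.sub_singleton_eq (R := ℂ) M 1
  rw [map_one] at this
  rw [← this]
  exact ⟨z, hz, 1, rfl, rfl⟩

end FiniteRank

lemma exists_sqrt_path {A : Type*} [CStarAlgebra A] (b : selfAdjoint A) :
    ∃ W : ℝ → unitary A, Continuous W ∧ W 0 = 1 ∧ W 1 * W 1 = selfAdjoint.expUnitary b ∧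
      ∀ s, (W s : A) = NormedSpace.exp ((Complex.I * (s / 2 : ℝ)) • (b : A)) := by
  refine ⟨fun s => selfAdjoint.expUnitary ((s / 2) • b), by fun_prop, by simp, ?_, fun s => ?_⟩
  · rw [← Commute.expUnitary_add (Commute.refl _), ← add_smul]
    norm_num
  · rw [selfAdjoint.expUnitary_coe, mul_smul, selfAdjoint.val_smul]
    congr 2

/-! ### Conjugation by an antiunitary, and the endpoint correction. -/

section AntiunitaryConj

variable {H : Type*} [NormedAddCommGroup H] [InnerProductSpace ℂ H]

/-- Polarization: `T` preserves norms and turns `i` into `-i`, which swaps the two imaginary terms.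
-/
lemma inner_antiunitary_map_map (T : H ≃ₗᵢ⋆[ℂ] H) (x y : H) :
    inner ℂ (T x) (T y) = (starRingEnd ℂ) (inner ℂ x y) := by
  have h1 : T x - (RCLike.I : ℂ) • T y = T (x + (RCLike.I : ℂ) • y) := by
    rw [map_add, LinearIsometryEquiv.map_smulₛₗ]
    simp [sub_eq_add_neg]
  have h2 : T x + (RCLike.I : ℂ) • T y = T (x - (RCLike.I : ℂ) • y) := by
    rw [map_sub, LinearIsometryEquiv.map_smulₛₗ]
    simp [sub_eq_add_neg]
  have h3 : ‖T x + T y‖ = ‖x + y‖ := by rw [← map_add, LinearIsometryEquiv.norm_map]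
  have h4 : ‖T x - T y‖ = ‖x - y‖ := by rw [← map_sub, LinearIsometryEquiv.norm_map]
  rw [inner_eq_sum_norm_sq_div_four, inner_eq_sum_norm_sq_div_four, h1, h2, h3, h4,
    LinearIsometryEquiv.norm_map, LinearIsometryEquiv.norm_map]
  simp only [map_div₀, map_add, map_sub, map_mul, map_pow, RCLike.conj_ofReal, RCLike.conj_I,
    map_ofNat]
  ring

/-- Conjugation of bounded operators by an antiunitary. -/
def trConj (T : H ≃ₗᵢ⋆[ℂ] H) : (H →L[ℂ] H) →+* (H →L[ℂ] H) where
  toFun A := (T.toContinuousLinearEquiv : H →SL[starRingEnd ℂ] H).comp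
    (A.comp (T.symm.toContinuousLinearEquiv : H →SL[starRingEnd ℂ] H))
  map_one' := by ext x; simp
  map_zero' := by ext x; simp
  map_mul' A B := by ext x; simp
  map_add' A B := by ext x; simp

lemma trConj_apply (T : H ≃ₗᵢ⋆[ℂ] H) (A : H →L[ℂ] H) (x : H) :
    trConj T A x = T (A (T.symm x)) := rfl

lemma trConj_apply_map (T : H ≃ₗᵢ⋆[ℂ] H) (A : H →L[ℂ] H) (x : H) :
    trConj T A (T x) = T (A x) := by simp [trConj_apply]

lemma trConj_smul (T : H ≃ₗᵢ⋆[ℂ] H) (c : ℂ) (A : H →L[ℂ] H) :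
    trConj T (c • A) = (starRingEnd ℂ) c • trConj T A := by
  ext x
  simp [trConj_apply, LinearIsometryEquiv.map_smulₛₗ]

lemma continuous_trConj (T : H ≃ₗᵢ⋆[ℂ] H) : Continuous (trConj T) := by
  refine AddMonoidHomClass.continuous_of_bound (trConj T) 1 fun A => ?_
  refine ContinuousLinearMap.opNorm_le_bound _ (by positivity) fun x => ?_
  rw [trConj_apply, LinearIsometryEquiv.norm_map, one_mul]
  exact (A.le_opNorm _).trans (by rw [LinearIsometryEquiv.norm_map])

lemma IsFermionicTR.symm_apply {T : H ≃ₗᵢ⋆[ℂ] H} (hT : IsFermionicTR T) (x : H) :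
    T.symm x = -T x := by
  rw [LinearIsometryEquiv.symm_apply_eq, map_neg, hT, neg_neg]

lemma IsFermionicTR.trConj_trConj {T : H ≃ₗᵢ⋆[ℂ] H} (hT : IsFermionicTR T) (A : H →L[ℂ] H) :
    trConj T (trConj T A) = A := by
  ext x
  simp [trConj_apply, hT.symm_apply, hT _]

lemma trConj_mem_finiteRankIdeal (T : H ≃ₗᵢ⋆[ℂ] H) {A : H →L[ℂ] H} (hA : A ∈ finiteRankIdeal H) :
    trConj T A ∈ finiteRankIdeal H := by
  rw [mem_finiteRankIdeal] at hA ⊢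
  let f : LinearMap.range (A : H →ₗ[ℂ] H) →ₛₗ[starRingEnd ℂ]
      LinearMap.range (trConj T A : H →ₗ[ℂ] H) :=
    { toFun := fun y => ⟨T y, by
        obtain ⟨_, x, rfl⟩ := y
        exact ⟨T x, trConj_apply_map T A x⟩⟩
      map_add' := fun x y => by ext; simp
      map_smul' := fun c x => by ext; simp [LinearIsometryEquiv.map_smulₛₗ] }
  refine Module.Finite.of_surjective f ?_
  rintro ⟨_, x, rfl⟩
  exact ⟨⟨A (T.symm x), T.symm x, rfl⟩, rfl⟩

variable [CompleteSpace H]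

lemma trConj_star (T : H ≃ₗᵢ⋆[ℂ] H) (A : H →L[ℂ] H) : trConj T (star A) = star (trConj T A) := by
  rw [ContinuousLinearMap.star_eq_adjoint, ContinuousLinearMap.star_eq_adjoint,
    ContinuousLinearMap.eq_adjoint_iff]
  intro x y
  obtain ⟨x, rfl⟩ := T.surjective x
  obtain ⟨y, rfl⟩ := T.surjective y
  rw [trConj_apply_map, trConj_apply_map, inner_antiunitary_map_map, inner_antiunitary_map_map,
    ContinuousLinearMap.adjoint_inner_left]

/-- Conjugation of unitaries by an antiunitary. -/
def trConjUnitary (T : H ≃ₗᵢ⋆[ℂ] H) (V : unitary (H →L[ℂ] H)) : unitary (H →L[ℂ] H) :=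
  ⟨trConj T V, by
    rw [Unitary.mem_iff, ← trConj_star, ← map_mul, ← map_mul]
    simp⟩

lemma coe_trConjUnitary (T : H ≃ₗᵢ⋆[ℂ] H) (V : unitary (H →L[ℂ] H)) :
    (trConjUnitary T V : H →L[ℂ] H) = trConj T V := rfl

lemma trConjUnitary_one (T : H ≃ₗᵢ⋆[ℂ] H) : trConjUnitary T 1 = 1 := by
  ext1; simp [coe_trConjUnitary]

lemma trConjUnitary_mul (T : H ≃ₗᵢ⋆[ℂ] H) (V W : unitary (H →L[ℂ] H)) :
    trConjUnitary T (V * W) = trConjUnitary T V * trConjUnitary T W := by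
  ext1; simp [coe_trConjUnitary]

lemma continuous_trConjUnitary (T : H ≃ₗᵢ⋆[ℂ] H) : Continuous (trConjUnitary T) :=
  ((continuous_trConj T).comp continuous_subtype_val).subtype_mk _

lemma IsFermionicTR.trConjUnitary_trConjUnitary {T : H ≃ₗᵢ⋆[ℂ] H} (hT : IsFermionicTR T)
    (V : unitary (H →L[ℂ] H)) : trConjUnitary T (trConjUnitary T V) = V := by
  ext1; simp [coe_trConjUnitary, hT.trConj_trConj]

-- Both sides are conjugate-linear in the operator; one is multiplicative and the other reverses
-- products, which makes no difference among polynomials in the single operator `M`.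
open Polynomial in
lemma trConj_aeval (T : H ≃ₗᵢ⋆[ℂ] H) {M : H →L[ℂ] H} (hM : trConj T M = star M) (q : ℂ[X]) :
    trConj T (aeval M q) = star (aeval M q) := by
  induction q using Polynomial.induction_on with
  | C c => simp [Algebra.algebraMap_eq_smul_one, trConj_smul]
  | add p q hp hq => simp [hp, hq]
  | monomial k c hk =>
    have h1 : (C c * X ^ (k + 1) : ℂ[X]) = (C c * X ^ k) * X := by rw [pow_succ, mul_assoc]
    have h2 : (C c * X ^ (k + 1) : ℂ[X]) = X * (C c * X ^ k) := by rw [h1, mul_comm]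
    conv_lhs => rw [h1, map_mul, map_mul, aeval_X, hk, hM]
    rw [h2, map_mul (aeval M) X, aeval_X, star_mul]

open Polynomial in
lemma Commute.aeval_left {A : Type*} [Ring A] [Algebra ℂ A] {M b : A} (h : Commute M b) (q : ℂ[X]) :
    Commute (aeval M q) b := by
  induction q using Polynomial.induction_on with
  | C c => rw [aeval_C]; exact Algebra.commutes c b
  | add p q hp hq => simpa using hp.add_left hq
  | monomial k c hk =>
    have h1 : (C c * X ^ (k + 1) : ℂ[X]) = (C c * X ^ k) * X := by rw [pow_succ, mul_assoc]
    rw [h1, map_mul, aeval_X]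
    exact hk.mul_left h

/-- A unitary `V`, of the form identity plus finite rank, between two `T`-invariant projections can
be corrected by the endpoint of a path in the commutant so as to commute with `T`. -/
lemma exists_path_correction {T : H ≃ₗᵢ⋆[ℂ] H} (hT : IsFermionicTR T) {p q : H →L[ℂ] H}
    (hp : trConj T p = p) (hq : trConj T q = q) (hps : star p = p) (hqs : star q = q)
    (V : unitary (H →L[ℂ] H)) (hV : q * V = V * p)
    (hVI : (V : H →L[ℂ] H) - 1 ∈ finiteRankIdeal H) :
    ∃ W : ℝ → unitary (H →L[ℂ] H), Continuous W ∧ W 0 = 1 ∧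
      (∀ s, p * (W s : H →L[ℂ] H) = W s * p) ∧ trConjUnitary T (V * W 1) = V * W 1 := by
  -- `M` is the defect: conjugating `V` by `T` gives `V M`. If `W² = M` and conjugation by `T`
  -- inverts `W`, then `V W` goes to `V M W⁻¹ = V W`.
  set M : unitary (H →L[ℂ] H) := star V * trConjUnitary T V with hMdef
  have hMc : (M : H →L[ℂ] H) = star (V : H →L[ℂ] H) * trConj T V := rfl
  have hMI : (M : H →L[ℂ] H) - 1 ∈ finiteRankIdeal H := by
    have : (M : H →L[ℂ] H) - 1 = star (V : H →L[ℂ] H) * (trConj T ((V : H →L[ℂ] H) - 1))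
        - star (V : H →L[ℂ] H) * ((V : H →L[ℂ] H) - 1) := by
      rw [hMc, map_sub, map_one, mul_sub, mul_sub, Unitary.coe_star_mul_self]
      abel
    rw [this]
    exact Ideal.sub_mem _ (Ideal.mul_mem_left _ _ (trConj_mem_finiteRankIdeal T hVI))
      (Ideal.mul_mem_left _ _ hVI)
  obtain ⟨b, r, hb, hbr⟩ :=
    exists_expUnitary_eq_of_finite_spectrum M (finite_spectrum_of_sub_one_mem hMI)
  have hMT : trConj T (M : H →L[ℂ] H) = star (M : H →L[ℂ] H) := by
    rw [hMc, map_mul, hT.trConj_trConj, trConj_star, star_mul, star_star]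
  have hbT : trConj T (b : H →L[ℂ] H) = b := by
    have h : star (b : H →L[ℂ] H) = b := b.2
    conv_lhs => rw [hbr, trConj_aeval T hMT, ← hbr, h]
  have hMp : Commute (M : H →L[ℂ] H) p := by
    have h1 : trConj T V * p = q * trConj T V := by
      have := congrArg (trConj T) hV
      rw [map_mul, map_mul, hp, hq] at this
      exact this.symm
    have h2 : star (V : H →L[ℂ] H) * q = p * star (V : H →L[ℂ] H) := by
      have := congrArg star hV
      rwa [star_mul, star_mul, hps, hqs] at this
    rw [Commute, SemiconjBy, hMc, mul_assoc, h1, ← mul_assoc, h2, mul_assoc]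
  have hbp : Commute (b : H →L[ℂ] H) p := by rw [hbr]; exact hMp.aeval_left r
  obtain ⟨W, hW, hW0, hW1, hWb⟩ := exists_sqrt_path b
  rw [hb] at hW1
  refine ⟨W, hW, hW0, ?_, ?_⟩
  · intro s
    rw [hWb]
    exact (Commute.exp_right (hbp.symm.smul_right _)).eq
  · have h2 : trConjUnitary T (W 1) = star (W 1) := by
      let +nondep : NormedAlgebra ℚ (H →L[ℂ] H) := .restrictScalars ℚ ℂ _
      have h : star (b : H →L[ℂ] H) = b := b.2
      ext1
      rw [coe_trConjUnitary, Unitary.coe_star, hWb, NormedSpace.map_exp _ (continuous_trConj T),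
        trConj_smul, NormedSpace.star_exp, hbT, star_smul, h]
      rfl
    have h4 : trConjUnitary T V = V * M := by rw [hMdef, ← mul_assoc]; simp
    rw [trConjUnitary_mul, h2, h4, ← hW1]
    simp [mul_assoc]

end AntiunitaryConj

instance fact_two_pi_pos : Fact (0 < 2 * π) := ⟨by positivity⟩

/-! ### Extension by time-reversal reflection. -/

section Reflect

variable {H : Type*} [NormedAddCommGroup H] [InnerProductSpace ℂ H] [CompleteSpace H]

/-- Extension of a family of unitaries from `t ≥ 0` to all `t` by time-reversal symmetry. -/
def reflectExtend (T : H ≃ₗᵢ⋆[ℂ] H) {K : Type*} [Neg K] (F : ℝ → K → unitary (H →L[ℂ] H))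
    (t : ℝ) (k : K) : unitary (H →L[ℂ] H) :=
  if 0 ≤ t then F t k else trConjUnitary T (F (-t) (-k))

variable {T : H ≃ₗᵢ⋆[ℂ] H} {K : Type*} [InvolutiveNeg K] {F : ℝ → K → unitary (H →L[ℂ] H)}

lemma reflectExtend_of_nonneg {t : ℝ} (ht : 0 ≤ t) (k : K) : reflectExtend T F t k = F t k :=
  if_pos ht

lemma reflectExtend_of_nonpos (h0 : ∀ k, F 0 k = trConjUnitary T (F 0 (-k))) {t : ℝ} (ht : t ≤ 0)
    (k : K) : reflectExtend T F t k = trConjUnitary T (F (-t) (-k)) := by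
  rcases ht.eq_or_lt with rfl | h
  · rw [reflectExtend_of_nonneg le_rfl, neg_zero, h0]
  · exact if_neg (not_le.mpr h)

lemma reflectExtend_neg (hT : IsFermionicTR T) (h0 : ∀ k, F 0 k = trConjUnitary T (F 0 (-k)))
    (t : ℝ) (k : K) : reflectExtend T F (-t) (-k) = trConjUnitary T (reflectExtend T F t k) := by
  rcases le_total 0 t with h | h
  · rw [reflectExtend_of_nonneg h, reflectExtend_of_nonpos h0 (by linarith), neg_neg, neg_neg]
  · rw [reflectExtend_of_nonneg (by linarith), reflectExtend_of_nonpos h0 h,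
      hT.trConjUnitary_trConjUnitary]

lemma continuous_reflectExtend [TopologicalSpace K] [ContinuousNeg K]
    (h0 : ∀ k, F 0 k = trConjUnitary T (F 0 (-k)))
    (hF : Continuous fun x : ℝ × K => F x.1 x.2) :
    Continuous fun x : ℝ × K => reflectExtend T F x.1 x.2 := by
  unfold reflectExtend
  refine Continuous.if_le hF ?_ continuous_const continuous_fst ?_
  · exact (continuous_trConjUnitary T).comp
      (hF.comp (f := fun x : ℝ × K => (-x.1, -x.2)) (by fun_prop))
  · rintro ⟨t, k⟩ rfl
    simpa using h0 k

lemma reflectExtend_intertwines (h0 : ∀ k, F 0 k = trConjUnitary T (F 0 (-k)))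
    {p : ℝ → K → H →L[ℂ] H} {p0 : H →L[ℂ] H} (hp0 : trConj T p0 = p0)
    (hp : ∀ t k, trConj T (p t k) = p (-t) (-k)) {a : ℝ}
    (hF : ∀ t ∈ Set.Icc 0 a, ∀ k, p t k * (F t k : H →L[ℂ] H) = F t k * p0) :
    ∀ t ∈ Set.Icc (-a) a, ∀ k,
      p t k * (reflectExtend T F t k : H →L[ℂ] H) = reflectExtend T F t k * p0 := by
  intro t ht k
  rcases le_total 0 t with h | h
  · rw [reflectExtend_of_nonneg h]
    exact hF t ⟨h, ht.2⟩ k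
  · have := congrArg (trConj T) (hF (-t) ⟨by linarith, by linarith [ht.1]⟩ (-k))
    rw [map_mul, map_mul, hp, hp0, neg_neg, neg_neg] at this
    rw [reflectExtend_of_nonpos h0 h, coe_trConjUnitary, this]

end Reflect

/-! ### The circle and uniform step sizes. -/

section Circle

lemma circ_pi_eq_neg_pi : ((π : ℝ) : Circ) = ((-π : ℝ) : Circ) := by
  rw [← sub_eq_zero, ← AddCircle.coe_sub]
  have : π - -π = 2 * π := by ring
  rw [this, AddCircle.coe_period]

lemma circ_neg_pi : -((π : ℝ) : Circ) = ((π : ℝ) : Circ) := by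
  rw [circ_pi_eq_neg_pi, ← AddCircle.coe_neg, neg_neg, circ_pi_eq_neg_pi]

lemma exists_rep_Icc (k : Circ) : ∃ s ∈ Set.Icc (-π) π, ((s : ℝ) : Circ) = k := by
  have : k ∈ (QuotientAddGroup.mk '' Set.Ico (-π) (-π + 2 * π) : Set Circ) := by
    rw [AddCircle.coe_image_Ico_eq]; trivial
  obtain ⟨s, hs, rfl⟩ := this
  exact ⟨s, ⟨hs.1, by linarith [hs.2]⟩, rfl⟩

/-- A continuous function on `[-π, π]` with equal end values descends to the circle. -/
lemma exists_descent_circ {B : Type*} [TopologicalSpace B] {f : ℝ → B} (hf : Continuous f)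
    (h : f (-π) = f π) : ∃ g : Circ → B, Continuous g ∧ ∀ s ∈ Set.Icc (-π) π, g (s : Circ) = f s := by
  have e : -π + 2 * π = π := by ring
  refine ⟨AddCircle.liftIco (2 * π) (-π) f, AddCircle.liftIco_continuous (by rw [e, h])
    hf.continuousOn, fun s hs => ?_⟩
  rcases hs.2.eq_or_lt with rfl | hlt
  · rw [circ_pi_eq_neg_pi, AddCircle.liftIco_coe_apply ⟨le_rfl, by linarith [Real.pi_pos]⟩, h]
  · exact AddCircle.liftIco_coe_apply ⟨hs.1, by rwa [e]⟩

lemma continuous_coe_circ : Continuous (fun t : ℝ => (t : Circ)) := AddCircle.continuous_mk' _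

lemma exists_uniform_step {E : Type*} [NormedAddCommGroup E] {P : Torus2 → E} (hP : Continuous P) :
    ∃ δ > 0, ∀ (x y : Circ) (s t : ℝ), |s - t| ≤ δ →
      ‖P ((s : Circ), x) - P ((t : Circ), x)‖ < 1 ∧ ‖P (y, (s : Circ)) - P (y, (t : Circ))‖ < 1 := by
  have hu := CompactSpace.uniformContinuous_of_continuous hP
  rw [Metric.uniformContinuous_iff] at hu
  obtain ⟨ε, hε, h⟩ := hu 1 one_pos
  have hc : Continuous fun t : ℝ => ‖(t : Circ)‖ := continuous_norm.comp continuous_coe_circ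
  obtain ⟨δ, hδ, hd⟩ := Metric.continuousAt_iff.mp (hc.continuousAt (x := 0)) ε hε
  have key : ∀ s t : ℝ, |s - t| ≤ δ / 2 → dist (s : Circ) (t : Circ) < ε := by
    intro s t hst
    rw [dist_eq_norm, ← AddCircle.coe_sub]
    have := hd (x := s - t) (by rw [Real.dist_eq, sub_zero]; linarith)
    simpa using this
  refine ⟨δ / 2, by positivity, fun x y s t hst => ⟨?_, ?_⟩⟩
  · rw [← dist_eq_norm]
    exact h (by rw [Prod.dist_eq]; simpa using key s t hst)
  · rw [← dist_eq_norm]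
    exact h (by rw [Prod.dist_eq]; simpa using key s t hst)

end Circle

/-! ### Equivariant unitaries trivialising `P`. -/

section Existence

variable {H : Type*} [NormedAddCommGroup H] [InnerProductSpace ℂ H] [CompleteSpace H]
variable {T : H ≃ₗᵢ⋆[ℂ] H} {r : ℕ} {P : Torus2 → H →L[ℂ] H}

lemma IsTRSProjMap.trConj_eq (hP : IsTRSProjMap T r P) (k : Torus2) :
    trConj T (P k) = P (-k) := by
  ext x
  obtain ⟨x, rfl⟩ := T.surjective x
  rw [trConj_apply_map, hP.symm]

lemma IsTRSProjMap.mem_finiteRankIdeal (hP : IsTRSProjMap T r P) (k : Torus2) :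
    P k ∈ finiteRankIdeal H := by
  rw [_root_.mem_finiteRankIdeal]
  exact Module.rank_lt_aleph0_iff.mp (by rw [hP.rank k]; exact Cardinal.natCast_lt_aleph0)

/-- Only half the circle is free; the other half is its mirror image. The halves meet at `π`
precisely when the unitary there commutes with `T`, which is what the endpoint correction provides.
-/
lemma IsTRSProjMap.exists_unitary_circle (hP : IsTRSProjMap T r P) (hT : IsFermionicTR T) :
    ∃ U : Circ → unitary (H →L[ℂ] H), Continuous U ∧
      (∀ k, P (0, k) * (U k : H →L[ℂ] H) = U k * P (0, 0)) ∧
      ∀ k, U (-k) = trConjUnitary T (U k) := by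
  obtain ⟨δ, hδ, hd⟩ := exists_uniform_step hP.continuous
  obtain ⟨V, hVc, hV0, hVp, hVI⟩ := exists_transport (K := Unit)
    (p := fun t _ => P (0, (t : Circ)))
    (hP.continuous.comp (continuous_const.prodMk (continuous_coe_circ.comp continuous_fst)))
    (fun t _ => hP.proj _) hδ (fun _ s t h => (hd 0 0 s t h).2) (finiteRankIdeal H)
    (fun t _ => hP.mem_finiteRankIdeal _) π
  have hp0 : trConj T (P (0, 0)) = P (0, 0) := by
    rw [hP.trConj_eq]; simp
  have hπ : trConj T (P (0, ((π : ℝ) : Circ))) = P (0, ((π : ℝ) : Circ)) := by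
    rw [hP.trConj_eq, Prod.neg_mk, neg_zero, circ_neg_pi]
  obtain ⟨W, hWc, hW0, hWp, hW1⟩ := exists_path_correction hT hp0 hπ
    (hP.proj _).isSelfAdjoint.star_eq (hP.proj _).isSelfAdjoint.star_eq (V π ())
    (by simpa using hVp π ⟨Real.pi_pos.le, le_rfl⟩ ()) (hVI π ())
  -- The correction is spread over `[0, π]`. Every `W s` commutes with `P (0, 0)`, so the
  -- intertwining survives.
  let F : ℝ → Unit → unitary (H →L[ℂ] H) := fun t k => V t k * W (t / π)
  have hFc : Continuous fun x : ℝ × Unit => F x.1 x.2 :=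
    hVc.mul (hWc.comp (continuous_fst.div_const π))
  have hF0 : ∀ k, F 0 k = trConjUnitary T (F 0 (-k)) := by
    intro k
    simp only [F, hV0, zero_div, hW0, mul_one, trConjUnitary_one]
  have hFp : ∀ t ∈ Set.Icc 0 π, ∀ k, P (0, (t : Circ)) * (F t k : H →L[ℂ] H) = F t k * P (0, 0) := by
    intro t ht k
    have := hVp t ht k
    rw [AddCircle.coe_zero] at this
    simp only [F, Submonoid.coe_mul]
    rw [← mul_assoc, this, mul_assoc, hWp, mul_assoc]
  have hRp := reflectExtend_intertwines (p := fun t _ => P (0, (t : Circ))) hF0 hp0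
    (fun t _ => by rw [hP.trConj_eq, Prod.neg_mk, neg_zero, AddCircle.coe_neg]) hFp
  have hRc := continuous_reflectExtend hF0 hFc
  obtain ⟨U, hUc, hU⟩ := exists_descent_circ (f := fun s => reflectExtend T F s ())
    (hRc.comp (f := fun s : ℝ => (s, ())) (by fun_prop)) (by
      have := reflectExtend_neg hT hF0 π ()
      refine (show _ = _ from this).trans ?_
      rw [reflectExtend_of_nonneg Real.pi_pos.le]
      simp only [F, div_self Real.pi_ne_zero]
      exact hW1)
  refine ⟨U, hUc, fun k => ?_, fun k => ?_⟩
  · obtain ⟨s, hs, rfl⟩ := exists_rep_Icc k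
    rw [hU s hs]
    exact hRp s hs ()
  · obtain ⟨s, hs, rfl⟩ := exists_rep_Icc k
    rw [← AddCircle.coe_neg, hU s hs, hU (-s) ⟨by linarith [hs.2], by linarith [hs.1]⟩]
    exact reflectExtend_neg hT hF0 s ()

/-- Equivariant unitary trivialisation of a time-reversal symmetric family of projections. -/
lemma IsTRSProjMap.exists_unitary (hP : IsTRSProjMap T r P) (hT : IsFermionicTR T) :
    ∃ U : ℝ → Circ → unitary (H →L[ℂ] H), (Continuous fun x : ℝ × Circ => U x.1 x.2) ∧
      (∀ t ∈ Set.Icc (-π) π, ∀ k : Circ,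
        P ((t : Circ), k) * (U t k : H →L[ℂ] H) = U t k * P (0, 0)) ∧
      ∀ t k, U (-t) (-k) = trConjUnitary T (U t k) := by
  obtain ⟨δ, hδ, hd⟩ := exists_uniform_step hP.continuous
  -- The ideal is `⊤` here: periodicity in `t` is not required, so no endpoint correction and no
  -- finite-rank control are needed.
  obtain ⟨V, hVc, hV0, hVp, -⟩ := exists_transport (K := Circ)
    (p := fun t k => P ((t : Circ), k))
    (hP.continuous.comp ((continuous_coe_circ.comp continuous_fst).prodMk continuous_snd))
    (fun t _ => hP.proj _) hδ (fun k s t h => (hd k 0 s t h).1) ⊤ (fun _ _ => trivial) π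
  obtain ⟨U₀, hU₀c, hU₀p, hU₀⟩ := hP.exists_unitary_circle hT
  have hp0 : trConj T (P (0, 0)) = P (0, 0) := by
    rw [hP.trConj_eq]; simp
  let F : ℝ → Circ → unitary (H →L[ℂ] H) := fun t k => V t k * U₀ k
  have hFc : Continuous fun x : ℝ × Circ => F x.1 x.2 := hVc.mul (hU₀c.comp continuous_snd)
  have hF0 : ∀ k, F 0 k = trConjUnitary T (F 0 (-k)) := by
    intro k
    simp only [F, hV0, one_mul, ← hU₀, neg_neg]
  have hFp : ∀ t ∈ Set.Icc 0 π, ∀ k, P ((t : Circ), k) * (F t k : H →L[ℂ] H)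
      = F t k * P (0, 0) := by
    intro t ht k
    have := hVp t ht k
    rw [AddCircle.coe_zero] at this
    simp only [F, Submonoid.coe_mul]
    rw [← mul_assoc, this, mul_assoc, hU₀p, mul_assoc]
  exact ⟨reflectExtend T F, continuous_reflectExtend hF0 hFc,
    reflectExtend_intertwines (p := fun t k => P ((t : Circ), k)) hF0 hp0
      (fun t k => by rw [hP.trConj_eq, Prod.neg_mk, AddCircle.coe_neg]) hFp,
    reflectExtend_neg hT hF0⟩

end Existence

/-! ### Matrices acting on finite families of vectors. -/

section Families

variable {H : Type*} [NormedAddCommGroup H] [InnerProductSpace ℂ H]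
variable {ι : Type*} [Fintype ι]

/-- The action of matrices on finite families of vectors. -/
def famMul (A : Matrix ι ι ℂ) (w : ι → H) : ι → H := fun j => ∑ a, A j a • w a

lemma famMul_apply (A : Matrix ι ι ℂ) (w : ι → H) (j : ι) : famMul A w j = ∑ a, A j a • w a := rfl

lemma famMul_mul (A B : Matrix ι ι ℂ) (w : ι → H) :
    famMul (A * B) w = famMul A (famMul B w) := by
  ext j
  simp only [famMul_apply, Matrix.mul_apply, Finset.sum_smul, Finset.smul_sum, smul_smul]
  exact Finset.sum_comm

lemma famMul_one [DecidableEq ι] (w : ι → H) : famMul 1 w = w := by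
  ext j
  simp [famMul_apply, Matrix.one_apply]

lemma famMul_injective {w : ι → H} (hw : Orthonormal ℂ w) {A B : Matrix ι ι ℂ}
    (h : famMul A w = famMul B w) : A = B := by
  ext i j
  have := congrArg (fun v => inner ℂ (w j) (v i)) h
  simpa [famMul_apply, hw.inner_right_fintype] using this

lemma antiunitary_famMul (T : H ≃ₗᵢ⋆[ℂ] H) (A : Matrix ι ι ℂ) (w : ι → H) :
    (fun j => T (famMul A w j)) = famMul (A.map (starRingEnd ℂ)) (fun j => T (w j)) := by
  ext j
  simp [famMul_apply, map_sum, LinearIsometryEquiv.map_smulₛₗ]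

/-- The matrix expressing the family `w'` in terms of the orthonormal family `w`. -/
def transMatrix (w w' : ι → H) : Matrix ι ι ℂ := Matrix.of fun j a => inner ℂ (w a) (w' j)

lemma famMul_transMatrix {w w' : ι → H} (hw : Orthonormal ℂ w)
    (h : ∀ j, w' j ∈ Submodule.span ℂ (Set.range w)) : famMul (transMatrix w w') w = w' := by
  ext j
  obtain ⟨c, hc⟩ := (Submodule.mem_span_range_iff_exists_fun ℂ).mp (h j)
  rw [← hc, famMul_apply]
  refine Finset.sum_congr rfl fun a _ => ?_
  simp [transMatrix, ← hc, hw.inner_right_fintype]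

lemma mul_conjTranspose_eq_one_of_famMul [DecidableEq ι] {A : Matrix ι ι ℂ} {w : ι → H}
    (hw : Orthonormal ℂ w) (hw' : Orthonormal ℂ (famMul A w)) : A * A.conjTranspose = 1 := by
  ext i j
  have h1 := orthonormal_iff_ite.mp hw' j i
  rw [famMul_apply, famMul_apply, hw.inner_sum] at h1
  simp only [Matrix.mul_apply, Matrix.conjTranspose_apply, Matrix.one_apply]
  simp only [eq_comm (a := i)]
  rw [← h1]
  exact Finset.sum_congr rfl fun a _ => mul_comm _ _

end Families

/-! ### Quaternionic orthonormal bases. -/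

section Quaternionic

variable {H : Type*} [NormedAddCommGroup H] [InnerProductSpace ℂ H]
variable {T : H ≃ₗᵢ⋆[ℂ] H} {n : ℕ}

lemma antiunitary_quatFamily (hT : IsFermionicTR T) (u : Fin n → H) :
    (fun j => T (quatFamily T u j)) = famMul (quatJ n) (quatFamily T u) := by
  ext j
  rcases j with j | j <;>
    simp [famMul_apply, quatFamily, quatJ, Fintype.sum_sum_type, Matrix.one_apply, hT _]

/-- Kramers degeneracy: antiunitarity applied to the pair `x`, `T x`, together with `T² = -1`, shows
that `⟨T x, x⟩` is its own negative. -/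
lemma inner_self_antiunitary (hT : IsFermionicTR T) (x : H) : inner ℂ x (T x) = 0 := by
  have h := inner_antiunitary_map_map T x (T x)
  rw [hT, inner_neg_right, inner_conj_symm] at h
  have h2 : inner ℂ (T x) x = 0 := by
    have : (2 : ℂ) * inner ℂ (T x) x = 0 := by linear_combination -h
    simpa using this
  rw [← inner_conj_symm, h2, map_zero]

lemma orthonormal_quatFamily_iff (u : Fin n → H) :
    Orthonormal ℂ (quatFamily T u) ↔
      (∀ i j, inner ℂ (u i) (u j) = if i = j then 1 else 0) ∧ ∀ i j, inner ℂ (u i) (T (u j)) = 0 := by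
  rw [orthonormal_iff_ite]
  constructor
  · intro h
    exact ⟨fun i j => by simpa [quatFamily] using h (Sum.inl i) (Sum.inl j),
      fun i j => by simpa [quatFamily] using h (Sum.inl i) (Sum.inr j)⟩
  · rintro ⟨h1, h2⟩ (i | i) (j | j)
    · simpa [quatFamily] using h1 i j
    · simpa [quatFamily] using h2 i j
    · simp only [quatFamily, Sum.elim_inl, Sum.elim_inr, reduceCtorEq, if_false]
      rw [← inner_conj_symm, h2, map_zero]
    · simp only [quatFamily, Sum.elim_inr, Sum.inr.injEq]
      rw [inner_antiunitary_map_map, h1]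
      split_ifs <;> simp

/-- Gram–Schmidt by Kramers pairs: a unit vector of `S` orthogonal to the pairs already chosen is
orthogonal to its own image under `T`, and that image is orthogonal to the earlier pairs because
their span is `T`-invariant. -/
lemma exists_partial_quatFamily (hT : IsFermionicTR T) {S : Submodule ℂ H}
    [FiniteDimensional ℂ S] (hS : ∀ x ∈ S, T x ∈ S) {N : ℕ} (hN : Module.finrank ℂ S = 2 * N) :
    ∀ m ≤ N, ∃ u : Fin m → H, Orthonormal ℂ (quatFamily T u) ∧ ∀ i, u i ∈ S := by
  intro m
  induction m with
  | zero => exact fun _ => ⟨Fin.elim0, (orthonormal_quatFamily_iff _).mpr ⟨fun i => i.elim0,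
      fun i => i.elim0⟩, fun i => i.elim0⟩
  | succ m ih =>
    intro hm
    obtain ⟨u, hu, huS⟩ := ih (by omega)
    have hle : Submodule.span ℂ (Set.range (quatFamily T u)) ≤ S := by
      rw [Submodule.span_le]
      rintro _ ⟨j | j, rfl⟩
      · exact huS j
      · exact hS _ (huS j)
    have hfd := FiniteDimensional.span_of_finite ℂ (Set.finite_range (quatFamily T u))
    have hne : (Submodule.span ℂ (Set.range (quatFamily T u)))ᗮ ⊓ S ≠ ⊥ := by
      intro h
      have := Submodule.sup_orthogonal_inf_of_hasOrthogonalProjection hle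
      rw [h, sup_bot_eq] at this
      rw [← this, finrank_span_eq_card hu.linearIndependent] at hN
      simp at hN
      omega
    obtain ⟨x, hx, hx0⟩ := Submodule.exists_mem_ne_zero_of_ne_bot hne
    have hxn : ‖x‖ ≠ 0 := norm_ne_zero_iff.mpr hx0
    set y : H := ((‖x‖⁻¹ : ℝ) : ℂ) • x with hy
    have hyS : y ∈ S := S.smul_mem _ hx.2
    have hyo : y ∈ (Submodule.span ℂ (Set.range (quatFamily T u)))ᗮ := Submodule.smul_mem _ _ hx.1
    have hyn : inner ℂ y y = 1 := by
      rw [inner_self_eq_norm_sq_to_K, hy, norm_smul]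
      simp [hxn]
    have h1 : ∀ i, inner ℂ (u i) y = 0 := fun i =>
      (Submodule.mem_orthogonal _ _).mp hyo _ (Submodule.subset_span ⟨Sum.inl i, rfl⟩)
    have h2 : ∀ i, inner ℂ (T (u i)) y = 0 := fun i =>
      (Submodule.mem_orthogonal _ _).mp hyo _ (Submodule.subset_span ⟨Sum.inr i, rfl⟩)
    obtain ⟨hu1, hu2⟩ := (orthonormal_quatFamily_iff _).mp hu
    refine ⟨Fin.cons y u, (orthonormal_quatFamily_iff _).mpr ⟨?_, ?_⟩, ?_⟩
    · intro i j
      refine Fin.cases ?_ (fun i => ?_) i <;> refine Fin.cases ?_ (fun j => ?_) j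
      · simpa using hyn
      · simp only [Fin.cons_zero, Fin.cons_succ]
        rw [← inner_conj_symm, h1, map_zero, if_neg (Fin.succ_ne_zero j).symm]
      · simp only [Fin.cons_zero, Fin.cons_succ]
        rw [h1, if_neg (Fin.succ_ne_zero i)]
      · simpa using hu1 i j
    · intro i j
      refine Fin.cases ?_ (fun i => ?_) i <;> refine Fin.cases ?_ (fun j => ?_) j
      · simpa using inner_self_antiunitary hT y
      · simp only [Fin.cons_zero, Fin.cons_succ]
        rw [← inner_conj_symm, h2, map_zero]
      · simp only [Fin.cons_zero, Fin.cons_succ]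
        have := inner_antiunitary_map_map T (T (u i)) y
        rw [h2, map_zero, hT, inner_neg_left, neg_eq_zero] at this
        exact this
      · simpa using hu2 i j
    · intro i
      refine Fin.cases ?_ (fun i => ?_) i
      · simpa using hyS
      · simpa using huS i

/-- Every `T`-invariant subspace of dimension `2n` has a quaternionic orthonormal basis. -/
lemma exists_quatFamily_span_eq (hT : IsFermionicTR T) {S : Submodule ℂ H}
    [FiniteDimensional ℂ S] (hS : ∀ x ∈ S, T x ∈ S) (hn : Module.finrank ℂ S = 2 * n) :
    ∃ u : Fin n → H, Orthonormal ℂ (quatFamily T u) ∧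
      Submodule.span ℂ (Set.range (quatFamily T u)) = S := by
  obtain ⟨u, hu, huS⟩ := exists_partial_quatFamily hT hS hn n le_rfl
  refine ⟨u, hu, Submodule.eq_of_le_of_finrank_eq ?_ ?_⟩
  · rw [Submodule.span_le]
    rintro _ ⟨j | j, rfl⟩
    · exact huS j
    · exact hS _ (huS j)
  · rw [finrank_span_eq_card hu.linearIndependent, hn]
    simp; omega

end Quaternionic

/-! ### Symmetric frames, their changes and their matching matrices. -/

section Frame

variable {H : Type*} [NormedAddCommGroup H] [InnerProductSpace ℂ H]

/-- A continuous time-reversal symmetric orthonormal frame of `P` over the cylinder. -/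
structure IsSymFrame (T : H ≃ₗᵢ⋆[ℂ] H) (P : Torus2 → H →L[ℂ] H) {n : ℕ}
    (w : ℝ → Circ → Fin n ⊕ Fin n → H) : Prop where
  cont : ∀ j, ContinuousOn (fun x : ℝ × Circ => w x.1 x.2 j) (Set.Icc (-π) π ×ˢ Set.univ)
  orthonormal : ∀ t ∈ Set.Icc (-π) π, ∀ k, Orthonormal ℂ (w t k)
  span : ∀ t ∈ Set.Icc (-π) π, ∀ k : Circ, Submodule.span ℂ (Set.range (w t k)) =
    LinearMap.range (P ((t : Circ), k) : H →ₗ[ℂ] H)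
  symm : ∀ t ∈ Set.Icc (-π) π, ∀ k, (fun j => T (w t k j)) = famMul (quatJ n) (w (-t) (-k))

variable {T : H ≃ₗᵢ⋆[ℂ] H} {P : Torus2 → H →L[ℂ] H} {n : ℕ}
  {w w' : ℝ → Circ → Fin n ⊕ Fin n → H}

lemma neg_mem_Icc_pi {t : ℝ} (ht : t ∈ Set.Icc (-π) π) : -t ∈ Set.Icc (-π) π :=
  ⟨by linarith [ht.2], by linarith [ht.1]⟩

lemma pi_mem_Icc_pi : π ∈ Set.Icc (-π) π := ⟨by linarith [Real.pi_pos], le_rfl⟩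

/-- The change-of-frame matrix. -/
def frameChange (w w' : ℝ → Circ → Fin n ⊕ Fin n → H) (t : ℝ) (k : Circ) :
    Matrix (Fin n ⊕ Fin n) (Fin n ⊕ Fin n) ℂ := transMatrix (w t k) (w' t k)

lemma famMul_frameChange (hw : IsSymFrame T P w) (hw' : IsSymFrame T P w') {t : ℝ}
    (ht : t ∈ Set.Icc (-π) π) (k : Circ) : famMul (frameChange w w' t k) (w t k) = w' t k := by
  refine famMul_transMatrix (hw.orthonormal t ht k) fun j => ?_
  rw [hw.span t ht, ← hw'.span t ht]
  exact Submodule.subset_span ⟨j, rfl⟩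

lemma frameChange_mul_conjTranspose (hw : IsSymFrame T P w) (hw' : IsSymFrame T P w') {t : ℝ}
    (ht : t ∈ Set.Icc (-π) π) (k : Circ) :
    frameChange w w' t k * (frameChange w w' t k).conjTranspose = 1 :=
  mul_conjTranspose_eq_one_of_famMul (hw.orthonormal t ht k)
    (by rw [famMul_frameChange hw hw' ht]; exact hw'.orthonormal t ht k)

/-- Apply `T` to `w' = G w` at `(t, k)` and compare coefficients in the frame at `(-t, -k)`;
antilinearity produces the conjugate. -/
lemma quatJ_mul_frameChange (hw : IsSymFrame T P w) (hw' : IsSymFrame T P w') {t : ℝ}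
    (ht : t ∈ Set.Icc (-π) π) (k : Circ) :
    quatJ n * frameChange w w' (-t) (-k)
      = (frameChange w w' t k).map (starRingEnd ℂ) * quatJ n := by
  have ht' := neg_mem_Icc_pi ht
  refine famMul_injective (hw.orthonormal (-t) ht' (-k)) ?_
  rw [famMul_mul, famMul_frameChange hw hw' ht', ← hw'.symm t ht, famMul_mul, ← hw.symm t ht,
    ← antiunitary_famMul, famMul_frameChange hw hw' ht]

lemma continuousOn_frameChange (hw : IsSymFrame T P w) (hw' : IsSymFrame T P w') :
    ContinuousOn (fun x : ℝ × Circ => frameChange w w' x.1 x.2) (Set.Icc (-π) π ×ˢ Set.univ) := by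
  refine continuousOn_pi.mpr fun j => continuousOn_pi.mpr fun a => ?_
  exact (hw.cont a).inner (𝕜 := ℂ) (hw'.cont j)

/-- The matching matrices of a frame. -/
def matching (w : ℝ → Circ → Fin n ⊕ Fin n → H) (k : Circ) :
    Matrix (Fin n ⊕ Fin n) (Fin n ⊕ Fin n) ℂ := transMatrix (w π k) (w (-π) k)

lemma famMul_matching (hw : IsSymFrame T P w) (k : Circ) :
    famMul (matching w k) (w π k) = w (-π) k := by
  refine famMul_transMatrix (hw.orthonormal π pi_mem_Icc_pi k) fun j => ?_
  rw [hw.span π pi_mem_Icc_pi, circ_pi_eq_neg_pi, ← hw.span (-π) (neg_mem_Icc_pi pi_mem_Icc_pi)]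
  exact Submodule.subset_span ⟨j, rfl⟩

lemma eq_matching_of_famMul (hw : IsSymFrame T P w) {k : Circ}
    {a : Matrix (Fin n ⊕ Fin n) (Fin n ⊕ Fin n) ℂ} (h : famMul a (w π k) = w (-π) k) :
    a = matching w k :=
  famMul_injective (hw.orthonormal π pi_mem_Icc_pi k) (by rw [h, famMul_matching hw])

lemma matching_mul_conjTranspose (hw : IsSymFrame T P w) (k : Circ) :
    matching w k * (matching w k).conjTranspose = 1 :=
  mul_conjTranspose_eq_one_of_famMul (hw.orthonormal π pi_mem_Icc_pi k)
    (by rw [famMul_matching hw]; exact hw.orthonormal _ (neg_mem_Icc_pi pi_mem_Icc_pi) k)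

lemma continuous_matching (hw : IsSymFrame T P w) : Continuous (matching w) := by
  refine continuous_pi fun j => continuous_pi fun a => ?_
  have h1 : ∀ t ∈ Set.Icc (-π) π, ∀ j, Continuous fun k : Circ => w t k j := fun t ht j =>
    (hw.cont j).comp_continuous (f := fun k : Circ => (t, k)) (by fun_prop) (fun k => ⟨ht, trivial⟩)
  exact (h1 π pi_mem_Icc_pi a).inner (𝕜 := ℂ) (h1 _ (neg_mem_Icc_pi pi_mem_Icc_pi) j)

/-- Apply `T` to the matching relation at `k`: it exchanges the ends `t = ±π` and sends `k` to `-k`,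
so `α(-k)` appears on the other side. -/
lemma map_star_mul_quatJ_mul_matching (hw : IsSymFrame T P w) (k : Circ) :
    (matching w k).map (starRingEnd ℂ) * quatJ n * matching w (-k) = quatJ n := by
  refine famMul_injective (hw.orthonormal π pi_mem_Icc_pi (-k)) ?_
  have h1 := hw.symm π pi_mem_Icc_pi k
  have h2 := hw.symm (-π) (neg_mem_Icc_pi pi_mem_Icc_pi) k
  rw [neg_neg] at h2
  rw [famMul_mul, famMul_matching hw, famMul_mul, ← h1, ← h2, ← antiunitary_famMul,
    famMul_matching hw]

lemma quatJ_mul_matching_transpose (hw : IsSymFrame T P w) {k : Circ} (hk : -k = k) :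
    quatJ n * (matching w k).transpose * (quatJ n)⁻¹ = matching w k := by
  have h1 := map_star_mul_quatJ_mul_matching hw k
  have h2 := transpose_mul_map_star (matching_mul_conjTranspose hw k)
  rw [hk] at h1
  set a := matching w k
  have h3 : a.transpose * quatJ n = quatJ n * a := by
    rw [← h1]
    simp only [← mul_assoc]
    rw [h2, one_mul, h1]
  rw [quatJ_inv, mul_neg, mul_assoc, h3, ← mul_assoc, quatJ_mul_self]
  simp

end Frame

/-! ### Continuous arguments and determinants of modulus one. -/

section Lift

/-- Continuous arguments on simply connected spaces. -/
lemma exists_continuous_argument {X : Type*} [TopologicalSpace X] [SimplyConnectedSpace X]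
    [LocallyPathConnectedSpace X] {f : X → ℂ} (hf : Continuous f) (hn : ∀ x, ‖f x‖ = 1) (x₀ : X)
    {θ₀ : ℝ} (h₀ : f x₀ = Complex.exp (Complex.I * (θ₀ : ℂ))) :
    ∃ θ : X → ℝ, Continuous θ ∧ θ x₀ = θ₀ ∧ ∀ x, f x = Complex.exp (Complex.I * (θ x : ℂ)) := by
  let g : C(X, Circle) := ⟨fun x => ⟨f x, mem_sphere_zero_iff_norm.mpr (hn x)⟩,
    hf.subtype_mk _⟩
  obtain ⟨F, ⟨hF0, hF⟩, -⟩ := Circle.isCoveringMap_exp.existsUnique_continuousMap_lifts g x₀ θ₀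
    (by
      ext
      rw [Circle.coe_exp, mul_comm]
      exact h₀.symm)
  refine ⟨F, F.continuous, hF0, fun x => ?_⟩
  have := congrArg (fun c : Circle => (c : ℂ)) (congrFun hF x)
  simp only [Function.comp_apply, Circle.coe_exp] at this
  rw [mul_comm, this]
  rfl

lemma exists_eq_exp_of_norm_eq_one {z : ℂ} (hz : ‖z‖ = 1) :
    ∃ l : ℝ, z = Complex.exp (Complex.I * (l : ℂ)) := by
  refine ⟨z.arg, ?_⟩
  have := Complex.norm_mul_exp_arg_mul_I z
  rw [hz] at this
  rw [mul_comm]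
  simpa using this.symm

lemma norm_det_eq_one {ι : Type*} [Fintype ι] [DecidableEq ι] {g : Matrix ι ι ℂ}
    (hu : g * g.conjTranspose = 1) : ‖g.det‖ = 1 := by
  have h := congrArg Matrix.det hu
  rw [Matrix.det_mul, Matrix.det_conjTranspose, Matrix.det_one] at h
  have h2 := congrArg norm h
  rw [norm_mul, norm_star, norm_one] at h2
  nlinarith [norm_nonneg g.det]

lemma det_quatJ_factorization {n : ℕ} (g : Matrix (Fin n ⊕ Fin n) (Fin n ⊕ Fin n) ℂ) :
    (quatJ n * g.transpose * (quatJ n)⁻¹ * g).det = g.det ^ 2 := by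
  have h : (quatJ n).det * ((quatJ n)⁻¹).det = 1 := by
    rw [← Matrix.det_mul, quatJ_mul_inv, Matrix.det_one]
  rw [Matrix.det_mul, Matrix.det_mul, Matrix.det_mul, Matrix.det_transpose]
  linear_combination g.det ^ 2 * h

end Lift

/-! ### Choices exist, and their value is a sign. -/

section ParityDataFrame

variable {H : Type*} [NormedAddCommGroup H] [InnerProductSpace ℂ H] [CompleteSpace H]
variable {T : H ≃ₗᵢ⋆[ℂ] H} {P : Torus2 → H →L[ℂ] H} {n r : ℕ}

lemma isSymFrame_of_unitary (hT : IsFermionicTR T)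
    {U : ℝ → Circ → unitary (H →L[ℂ] H)}
    (hUc : ContinuousOn (fun p : ℝ × Circ => U p.1 p.2) (Set.Icc (-π) π ×ˢ Set.univ))
    (hUP : ∀ t ∈ Set.Icc (-π) π, ∀ k : Circ,
      P ((t : Circ), k) ∘L (U t k : H →L[ℂ] H) = (U t k : H →L[ℂ] H) ∘L P (0, 0))
    (hUT : ∀ t ∈ Set.Icc (-π) π, ∀ (k : Circ) (x : H),
      T ((U t k : H →L[ℂ] H) x) = (U (-t) (-k) : H →L[ℂ] H) (T x))
    {u : Fin n → H} (hu : Orthonormal ℂ (quatFamily T u))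
    (hus : Submodule.span ℂ (Set.range (quatFamily T u)) =
      LinearMap.range (P (0, 0) : H →ₗ[ℂ] H)) :
    IsSymFrame T P fun t k j => (U t k : H →L[ℂ] H) (quatFamily T u j) where
  cont j := by
    have : ContinuousOn (fun p : ℝ × Circ => (U p.1 p.2 : H →L[ℂ] H))
      (Set.Icc (-π) π ×ˢ Set.univ) := continuous_subtype_val.comp_continuousOn hUc
    exact this.clm_apply continuousOn_const
  orthonormal t _ k := by
    rw [orthonormal_iff_ite] at hu ⊢
    intro i j
    rw [← hu i j]
    exact ContinuousLinearMap.inner_map_map_of_mem_unitary (U t k).2 _ _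
  span t ht k := by
    have h1 : Set.range (fun j => (U t k : H →L[ℂ] H) (quatFamily T u j))
        = ((U t k : H →L[ℂ] H) : H →ₗ[ℂ] H) '' Set.range (quatFamily T u) := by
      rw [← Set.range_comp]; rfl
    rw [h1, Submodule.span_image, hus]
    ext y
    constructor
    · rintro ⟨_, ⟨x, rfl⟩, rfl⟩
      exact ⟨(U t k : H →L[ℂ] H) x, congrArg (fun A : H →L[ℂ] H => A x) (hUP t ht k)⟩
    · rintro ⟨x, rfl⟩
      refine ⟨P (0, 0) (star (U t k : H →L[ℂ] H) x), ⟨_, rfl⟩, ?_⟩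
      have h2 := congrArg (fun A : H →L[ℂ] H => A (star (U t k : H →L[ℂ] H) x)) (hUP t ht k)
      have h3 : (U t k : H →L[ℂ] H) (star (U t k : H →L[ℂ] H) x) = x :=
        congrArg (fun A : H →L[ℂ] H => A x) (Unitary.coe_mul_star_self (U t k))
      simp only [ContinuousLinearMap.comp_apply, h3] at h2
      exact h2.symm
  symm t ht k := by
    ext j
    rw [hUT t ht k]
    have := congrFun (antiunitary_quatFamily hT u) j
    rw [this, famMul_apply, famMul_apply, map_sum]
    simp

/-- The frame of a set of choices. -/
def ParityData.frame (D : ParityData T P n) (t : ℝ) (k : Circ) (j : Fin n ⊕ Fin n) : H :=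
  (D.U t k : H →L[ℂ] H) (quatFamily T D.u j)

lemma ParityData.isSymFrame (hT : IsFermionicTR T) (D : ParityData T P n) : IsSymFrame T P D.frame :=
  isSymFrame_of_unitary hT D.U_cont D.U_intertwines D.U_symm D.u_orthonormal D.u_span

lemma ParityData.α_eq (hT : IsFermionicTR T) (D : ParityData T P n) (k : Circ) : D.α k = matching D.frame k :=
  eq_matching_of_famMul (D.isSymFrame hT) (funext fun j => (D.α_matching k j).symm)

/-- Forces the size `n` that `IsParityIndex` leaves existentially quantified. -/
lemma ParityData.two_mul_eq (hP : IsTRSProjMap T r P) (D : ParityData T P n) : 2 * n = r := by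
  have h := hP.rank (0, 0)
  rw [← D.u_span, rank_span D.u_orthonormal.linearIndependent,
    ← Set.cast_ncard (Set.finite_range _), Set.ncard_range_of_injective
      D.u_orthonormal.linearIndependent.injective] at h
  have := Nat.cast_injective h
  simp at this
  omega

lemma neg_coe_zero_circ : -((0 : ℝ) : Circ) = ((0 : ℝ) : Circ) := by
  rw [AddCircle.coe_zero, neg_zero]

lemma nonempty_parityData (hT : IsFermionicTR T) (hP : IsTRSProjMap T (2 * n) P) :
    Nonempty (ParityData T P n) := by
  obtain ⟨U, hUc, hUP, hUT⟩ := hP.exists_unitary hT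
  have hfd : FiniteDimensional ℂ (LinearMap.range (P (0, 0) : H →ₗ[ℂ] H)) :=
    hP.mem_finiteRankIdeal (0, 0)
  obtain ⟨u, hu, hus⟩ := exists_quatFamily_span_eq (n := n) hT
    (S := LinearMap.range (P (0, 0) : H →ₗ[ℂ] H)) (by
      rintro _ ⟨x, rfl⟩
      refine ⟨T x, ?_⟩
      have := hP.symm (0, 0) x
      simp only [Prod.neg_mk, neg_zero] at this
      exact this.symm) (Module.finrank_eq_of_rank_eq (hP.rank (0, 0)))
  have hUT' : ∀ t ∈ Set.Icc (-π) π, ∀ (k : Circ) (x : H),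
      T ((U t k : H →L[ℂ] H) x) = (U (-t) (-k) : H →L[ℂ] H) (T x) := by
    intro t _ k x
    rw [hUT, coe_trConjUnitary, trConj_apply_map]
  have hw := isSymFrame_of_unitary hT hUc.continuousOn hUP hUT' hu hus
  set w : ℝ → Circ → Fin n ⊕ Fin n → H := fun t k j => (U t k : H →L[ℂ] H) (quatFamily T u j)
  obtain ⟨γ₀, hγ₀⟩ := exists_quatJ_factorization (matching_mul_conjTranspose hw _)
    (quatJ_mul_matching_transpose hw neg_coe_zero_circ)
  obtain ⟨γπ, hγπ⟩ := exists_quatJ_factorization (matching_mul_conjTranspose hw _)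
    (quatJ_mul_matching_transpose hw circ_neg_pi)
  have hdet : ∀ k, ‖(matching w k).det‖ = 1 := fun k =>
    norm_det_eq_one (matching_mul_conjTranspose hw k)
  -- Unitarity of `γ` is not known, but `(det γ)² = det α` already puts its determinant on the unit
  -- circle.
  have hnorm : ∀ {k} {g : Matrix (Fin n ⊕ Fin n) (Fin n ⊕ Fin n) ℂ},
      matching w k = quatJ n * g.transpose * (quatJ n)⁻¹ * g → ‖g.det‖ = 1 := by
    intro k g h
    have h1 := hdet k
    rw [h, det_quatJ_factorization, norm_pow] at h1
    nlinarith [norm_nonneg g.det]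
  obtain ⟨l₀, hl₀⟩ := exists_eq_exp_of_norm_eq_one (hnorm hγ₀)
  obtain ⟨lπ, hlπ⟩ := exists_eq_exp_of_norm_eq_one (hnorm hγπ)
  obtain ⟨μ, hμc, hμ0, hμ⟩ := exists_continuous_argument
    (f := fun k : ℝ => (matching w (k : Circ)).det)
    (((continuous_matching hw).comp continuous_coe_circ).matrix_det) (fun k => hdet _) 0
    (θ₀ := 2 * l₀) (by
      rw [hγ₀, det_quatJ_factorization, hl₀, ← Complex.exp_nat_mul]
      congr 1
      push_cast
      ring)
  exact ⟨{ U := U, U_cont := hUc.continuousOn, U_intertwines := hUP, U_symm := hUT', u := u,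
           u_orthonormal := hu, u_span := hus, α := matching w,
           α_matching := fun k j => (congrFun (famMul_matching hw k) j).symm,
           γ₀ := γ₀, γπ := γπ, γ₀_spec := hγ₀, γπ_spec := hγπ, l₀ := l₀, lπ := lπ,
           l₀_spec := hl₀, lπ_spec := hlπ, μ := μ, μ_cont := hμc.continuousOn,
           μ_spec := fun k _ => hμ k, μ_zero := hμ0 }⟩

/-- The square is `(det γπ)² / det α(π)`. -/
lemma ParityData.value_sq (D : ParityData T P n) : D.value ^ 2 = 1 := by
  have h1 := D.μ_spec π ⟨Real.pi_pos.le, le_rfl⟩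
  rw [D.γπ_spec, det_quatJ_factorization, D.lπ_spec, ← Complex.exp_nat_mul] at h1
  rw [ParityData.value, ← Complex.exp_nat_mul]
  have e : ((2 : ℕ) : ℂ) * (Complex.I * (((2 * D.lπ - D.μ π) / 2 : ℝ) : ℂ))
      = ((2 : ℕ) : ℂ) * (Complex.I * (D.lπ : ℂ)) - Complex.I * (D.μ π : ℂ) := by
    push_cast; ring
  rw [e, Complex.exp_sub, h1, div_self (Complex.exp_ne_zero _)]

end ParityDataFrame

/-! ### Parity of winding numbers. -/

section Winding

open Complex in
lemma eq_of_exp_eq_one {c : ℝ → ℝ} {a b : ℝ} (hab : a ≤ b) (hc : ContinuousOn c (Set.Icc a b))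
    (h : ∀ t ∈ Set.Icc a b, exp (I * (c t : ℂ)) = 1) : c a = c b := by
  have hd : DiscreteTopology (Set.range ((↑) : ℤ → ℝ)) :=
    Int.isClosedEmbedding_coe_real.isEmbedding.toHomeomorph.symm.isEmbedding.discreteTopology
  have hm : Set.MapsTo (fun t => c t / (2 * π)) (Set.Icc a b) (Set.range ((↑) : ℤ → ℝ)) := by
    intro t ht
    obtain ⟨n, hn⟩ := exp_eq_one_iff.mp (h t ht)
    refine ⟨n, ?_⟩
    have : (c t : ℂ) = ((n * (2 * π) : ℝ) : ℂ) := by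
      apply mul_left_cancel₀ I_ne_zero
      rw [hn]; push_cast; ring
    have := ofReal_injective this
    simp only [this]
    field_simp
  have := isPreconnected_Icc.constant_of_mapsTo ⟨hd⟩ (hc.div_const _) hm
    (Set.left_mem_Icc.mpr hab) (Set.right_mem_Icc.mpr hab)
  field_simp at this
  exact this

open Complex in
/-- A loop homotopic to a loop `g` with `g (-k) = conj (g k)` and `g 0 = g π = 1` has even winding
number. -/
lemma exp_half_winding_eq_one {θ : ℝ × ℝ → ℝ} (hθ : Continuous θ)
    (hper : ∀ t ∈ Set.Icc 0 π, exp (I * (θ (t, π) : ℂ)) = exp (I * (θ (t, -π) : ℂ)))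
    (hsym : ∀ k ∈ Set.Icc 0 π, exp (I * (θ (0, k) : ℂ)) * exp (I * (θ (0, -k) : ℂ)) = 1)
    (h0 : exp (I * (θ (0, 0) : ℂ)) = 1) (hπ : exp (I * (θ (0, π) : ℂ)) = 1) :
    exp (I * (((θ (π, π) - θ (π, -π)) / 2 : ℝ) : ℂ)) = 1 := by
  -- Homotopy invariance: the variation around the loop lies in `2πℤ` for each `t`, so it may be
  -- computed at `t = 0`.
  have h1 := eq_of_exp_eq_one (c := fun t => θ (t, π) - θ (t, -π)) Real.pi_pos.le
    (by fun_prop) (fun t ht => by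
      push_cast
      rw [mul_sub, exp_sub, hper t ht, div_self (exp_ne_zero _)])
  -- By reflection symmetry the full variation is twice that over `[0, π]`, itself a multiple of
  -- `2π` since both end values are `1`.
  have h2 := eq_of_exp_eq_one (c := fun k => θ (0, k) + θ (0, -k)) Real.pi_pos.le
    (by fun_prop) (fun k hk => by
      push_cast
      rw [mul_add, exp_add, hsym k hk])
  simp only [neg_zero] at h1 h2
  have e : (θ (π, π) - θ (π, -π)) / 2 = θ (0, π) - θ (0, 0) := by linarith
  rw [e]
  push_cast
  rw [mul_sub, exp_sub, h0, hπ, div_one]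

end Winding

/-! ### Independence of the choices. -/

section Independence

variable {H : Type*} [NormedAddCommGroup H] [InnerProductSpace ℂ H]
variable {T : H ≃ₗᵢ⋆[ℂ] H} {P : Torus2 → H →L[ℂ] H} {n : ℕ}
  {w w' : ℝ → Circ → Fin n ⊕ Fin n → H}

lemma matching_eq_of_frameChange (hw : IsSymFrame T P w) (hw' : IsSymFrame T P w') (k : Circ) :
    matching w' k
      = frameChange w w' (-π) k * matching w k * (frameChange w w' π k).conjTranspose := by
  have hπ := pi_mem_Icc_pi
  refine (eq_matching_of_famMul hw' ?_).symm
  rw [← famMul_frameChange hw hw' hπ, famMul_mul, ← famMul_mul _ (frameChange w w' π k),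
    mul_eq_one_comm.mp (frameChange_mul_conjTranspose hw hw' hπ k), famMul_one, famMul_mul,
    famMul_matching hw, famMul_frameChange hw hw' (neg_mem_Icc_pi hπ)]

lemma det_map_star {ι : Type*} [Fintype ι] [DecidableEq ι] (g : Matrix ι ι ℂ) :
    (g.map (starRingEnd ℂ)).det = (starRingEnd ℂ) g.det := by
  rw [RingHom.map_det]; rfl

lemma det_frameChange_neg (hw : IsSymFrame T P w) (hw' : IsSymFrame T P w') {t : ℝ}
    (ht : t ∈ Set.Icc (-π) π) (k : Circ) :
    (frameChange w w' (-t) (-k)).det = (starRingEnd ℂ) (frameChange w w' t k).det := by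
  have h := congrArg Matrix.det (quatJ_mul_frameChange hw hw' ht k)
  rw [Matrix.det_mul, Matrix.det_mul, det_map_star, mul_comm] at h
  exact mul_right_cancel₀ (quatJ_det_ne_zero n) h

lemma star_mul_self_of_norm_eq_one {z : ℂ} (hz : ‖z‖ = 1) : (starRingEnd ℂ) z * z = 1 := by
  rw [← Complex.normSq_eq_conj_mul_self, Complex.normSq_eq_norm_sq, hz]; simp

lemma norm_det_frameChange (hw : IsSymFrame T P w) (hw' : IsSymFrame T P w') {t : ℝ}
    (ht : t ∈ Set.Icc (-π) π) (k : Circ) : ‖(frameChange w w' t k).det‖ = 1 :=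
  norm_det_eq_one (frameChange_mul_conjTranspose hw hw' ht k)

/-- The frame changes at both ends contribute, but `det G(-π, k)` is the conjugate of `det G(π,
-k)`, so everything can be expressed at `t = π`. -/
lemma det_matching_mul (hw : IsSymFrame T P w) (hw' : IsSymFrame T P w') (k : Circ) :
    (matching w' k).det * ((frameChange w w' π k).det * (frameChange w w' π (-k)).det)
      = (matching w k).det := by
  have h := congrArg Matrix.det (matching_eq_of_frameChange hw hw' k)
  have h1 := det_frameChange_neg hw hw' pi_mem_Icc_pi (-k)
  rw [neg_neg] at h1
  rw [Matrix.det_mul, Matrix.det_mul, Matrix.det_conjTranspose, h1] at h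
  have h2 := star_mul_self_of_norm_eq_one (norm_det_frameChange hw hw' pi_mem_Icc_pi k)
  have h3 := star_mul_self_of_norm_eq_one (norm_det_frameChange hw hw' pi_mem_Icc_pi (-k))
  rw [h, ← starRingEnd_apply]
  linear_combination (matching w k).det * ((starRingEnd ℂ) (frameChange w w' π (-k)).det *
    (frameChange w w' π (-k)).det) * h2 + (matching w k).det * h3

/-- At a fixed point `G(-π, k) = J conj(G) J⁻¹` for `G = G(π, k)`, so `g G*` is a factor of the new
matching matrix and has the same determinant as `g'`. -/
lemma det_factor_mul (hw : IsSymFrame T P w) (hw' : IsSymFrame T P w') {k : Circ} (hk : -k = k)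
    {g g' : Matrix (Fin n ⊕ Fin n) (Fin n ⊕ Fin n) ℂ} (hg0 : g.det ≠ 0)
    (hg : matching w k = quatJ n * g.transpose * (quatJ n)⁻¹ * g)
    (hg' : matching w' k = quatJ n * g'.transpose * (quatJ n)⁻¹ * g') :
    g'.det * (frameChange w w' π k).det = g.det := by
  have h2 := star_mul_self_of_norm_eq_one (norm_det_frameChange hw hw' pi_mem_Icc_pi k)
  have hq := quatJ_mul_frameChange hw hw' pi_mem_Icc_pi k
  rw [hk] at hq
  have hm := matching_eq_of_frameChange hw hw' k
  set G := frameChange w w' π k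
  have hG : G.conjTranspose.transpose = G.map (starRingEnd ℂ) := by
    ext i j; simp [Matrix.conjTranspose_apply]
  have hq' : frameChange w w' (-π) k = -(quatJ n * (G.map (starRingEnd ℂ) * quatJ n)) := by
    rw [← hq, ← mul_assoc, quatJ_mul_self]; simp
  have hdet : g'.det = (g * G.conjTranspose).det := by
    apply det_eq_det_of_quatJ_congr
    · rw [Matrix.det_mul, Matrix.det_conjTranspose]
      refine mul_ne_zero hg0 fun h0 => ?_
      rw [← starRingEnd_apply] at h0
      rw [h0, zero_mul] at h2
      exact zero_ne_one h2
    · rw [← hg', hm, hq', hg, Matrix.transpose_mul, hG]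
      have : ∀ X : Matrix (Fin n ⊕ Fin n) (Fin n ⊕ Fin n) ℂ,
          quatJ n * (quatJ n * X) = -X := fun X => by
        rw [← mul_assoc, quatJ_mul_self]; simp
      simp only [mul_assoc, neg_mul, this]
      simp only [mul_neg, neg_neg]
  rw [hdet, Matrix.det_mul, Matrix.det_conjTranspose, ← starRingEnd_apply]
  linear_combination g.det * h2

variable [CompleteSpace H]

open Complex in
/-- The index does not depend on the choices. -/
lemma ParityData.value_eq (hT : IsFermionicTR T) (D D' : ParityData T P n) :
    D'.value = D.value := by
  have hw := D.isSymFrame hT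
  have hw' := D'.isSymFrame hT
  set w := D.frame
  set w' := D'.frame
  have hπ0 := Real.pi_pos
  have hmπ := pi_mem_Icc_pi
  have h0m : (0 : ℝ) ∈ Set.Icc (-π) π := ⟨by linarith, hπ0.le⟩
  have hclamp : ∀ t : ℝ, max (-π) (min π t) ∈ Set.Icc (-π) π := fun t =>
    ⟨le_max_left _ _, max_le (by linarith) (min_le_left _ _)⟩
  have hclamp' : ∀ t ∈ Set.Icc 0 π, max (-π) (min π t) = t := fun t ht => by
    rw [min_eq_right ht.2, max_eq_right (by linarith [ht.1])]
  -- Clamping `t` and unrolling the circle give a function on the simply connected plane, where a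
  -- continuous argument exists.
  let f : ℝ × ℝ → ℂ := fun x => (frameChange w w' (max (-π) (min π x.1)) (x.2 : Circ)).det
  have hfc : Continuous f := by
    refine Continuous.matrix_det ?_
    exact (continuousOn_frameChange hw hw').comp_continuous
      (f := fun x : ℝ × ℝ => (max (-π) (min π x.1), (x.2 : Circ)))
      (by
        refine Continuous.prodMk (by fun_prop) (continuous_coe_circ.comp continuous_snd))
      (fun x => ⟨hclamp _, trivial⟩)
  have hfn : ∀ x, ‖f x‖ = 1 := fun x => norm_det_frameChange hw hw' (hclamp _) _
  have hf : ∀ t ∈ Set.Icc 0 π, ∀ k : ℝ, f (t, k) = (frameChange w w' t (k : Circ)).det :=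
    fun t ht k => by simp only [f, hclamp' t ht]
  obtain ⟨θ₀, hθ₀⟩ := exists_eq_exp_of_norm_eq_one (hfn 0)
  obtain ⟨θ, hθc, -, hθ⟩ := exists_continuous_argument hfc hfn 0 hθ₀
  have hm0 : (0 : ℝ) ∈ Set.Icc 0 π := ⟨le_rfl, hπ0.le⟩
  have hm1 : π ∈ Set.Icc 0 π := ⟨hπ0.le, le_rfl⟩
  have hone : ∀ k : Circ, -k = k → (frameChange w w' 0 k).det = 1 := fun k hk => by
    refine det_eq_one_of_quatJ_mul_eq (frameChange_mul_conjTranspose hw hw' h0m k) ?_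
    have := quatJ_mul_frameChange hw hw' h0m k
    rwa [neg_zero, hk] at this
  have hwind : exp (I * (((θ (π, π) - θ (π, -π)) / 2 : ℝ) : ℂ)) = 1 := by
    refine exp_half_winding_eq_one hθc (fun t ht => ?_) (fun k _ => ?_) ?_ ?_
    · rw [← hθ, ← hθ, hf t ht, hf t ht, circ_pi_eq_neg_pi]
    · have := det_frameChange_neg hw hw' h0m (k : Circ)
      rw [neg_zero] at this
      rw [← hθ, ← hθ, hf 0 hm0, hf 0 hm0, AddCircle.coe_neg, this, mul_comm]
      exact star_mul_self_of_norm_eq_one (norm_det_frameChange hw hw' h0m _)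
    · rw [← hθ, hf 0 hm0, hone _ neg_coe_zero_circ]
    · rw [← hθ, hf 0 hm0, hone _ circ_neg_pi]
  have hc := eq_of_exp_eq_one (c := fun k => D'.μ k + (θ (π, k) + θ (π, -k)) - D.μ k) hπ0.le
    ((D'.μ_cont.add (by fun_prop)).sub D.μ_cont) (fun k hk => by
      push_cast
      rw [mul_sub, exp_sub, mul_add, exp_add, mul_add, exp_add, ← hθ, ← hθ, hf π hm1, hf π hm1,
        ← D'.μ_spec k hk, ← D.μ_spec k hk, D.α_eq hT, D'.α_eq hT, AddCircle.coe_neg,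
        det_matching_mul hw hw', ← D.α_eq hT, D.μ_spec k hk, div_self (exp_ne_zero _)])
  simp only [neg_zero, D.μ_zero, D'.μ_zero] at hc
  have hfac0 : exp (I * ((D'.l₀ + θ (π, 0) - D.l₀ : ℝ) : ℂ)) = 1 := by
    have := det_factor_mul hw hw' neg_coe_zero_circ (by rw [D.l₀_spec]; exact exp_ne_zero _)
      ((D.α_eq hT _).symm.trans D.γ₀_spec) ((D'.α_eq hT _).symm.trans D'.γ₀_spec)
    push_cast
    rw [mul_sub, exp_sub, mul_add, exp_add, ← hθ, hf π hm1, ← D.l₀_spec, ← D'.l₀_spec, this,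
      D.l₀_spec, div_self (exp_ne_zero _)]
  have hfacπ : exp (I * ((D'.lπ + θ (π, π) - D.lπ : ℝ) : ℂ)) = 1 := by
    have := det_factor_mul hw hw' circ_neg_pi (by rw [D.lπ_spec]; exact exp_ne_zero _)
      ((D.α_eq hT _).symm.trans D.γπ_spec) ((D'.α_eq hT _).symm.trans D'.γπ_spec)
    push_cast
    rw [mul_sub, exp_sub, mul_add, exp_add, ← hθ, hf π hm1, ← D.lπ_spec, ← D'.lπ_spec, this,
      D.lπ_spec, div_self (exp_ne_zero _)]
  -- Follows from `hc`. The three corrections are killed by `hfacπ`, `hfac0` and `hwind`; only the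
  -- last needs the even winding.
  have e : (2 * D'.lπ - D'.μ π) / 2 = (2 * D.lπ - D.μ π) / 2 + (D'.lπ + θ (π, π) - D.lπ)
      - (D'.l₀ + θ (π, 0) - D.l₀) - (θ (π, π) - θ (π, -π)) / 2 := by linarith
  rw [ParityData.value, ParityData.value, e, ofReal_sub, ofReal_sub, ofReal_add, mul_sub, mul_sub,
    mul_add, exp_sub, exp_sub, exp_add, hfac0, hfacπ, hwind]
  simp

end Independence

/-! ### Gluing unitaries along orthogonal projections. -/

section GluedUnitary

variable {A : Type*} [Ring A] [StarRing A]

lemma star_add_three_mul {x y z p q e : A} (hx : star x * x = p) (hy : star y * y = q)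
    (hz : star z * z = e) (hxy : star x * y = 0) (hxz : star x * z = 0) (hyz : star y * z = 0) :
    star (x + y + z) * (x + y + z) = p + q + e := by
  have hyx : star y * x = 0 := by simpa using congrArg star hxy
  have hzx : star z * x = 0 := by simpa using congrArg star hxz
  have hzy : star z * y = 0 := by simpa using congrArg star hyz
  simp only [star_add, add_mul, mul_add, hx, hy, hz, hxy, hxz, hyz, hyx, hzx, hzy]
  abel

variable {p q p' q' a b c : A}

lemma IsStarProjection.mul_eq_zero_comm (hp : IsStarProjection p) (hq : IsStarProjection q)
    (h : p * q = 0) : q * p = 0 := by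
  have := congrArg star h
  rwa [star_mul, hp.isSelfAdjoint.star_eq, hq.isSelfAdjoint.star_eq, star_zero] at this

/-- The summands are partial isometries with initial projections `p`, `q`, `1 - (p + q)`; the
intertwining relations make their final projections orthogonal, so cross terms vanish. -/
lemma star_glue_mul_glue (hp : IsStarProjection p) (hq : IsStarProjection q)
    (hp' : IsStarProjection p') (hq' : IsStarProjection q') (hpq : p * q = 0)
    (hpq' : p' * q' = 0) (ha : star a * a = 1) (hb : star b * b = 1) (hc : star c * c = 1)
    (hap : p' * a = a * p) (hbq : q' * b = b * q) (hcpq : (p' + q') * c = c * (p + q)) :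
    star (a * p + b * q + c * (1 - (p + q))) * (a * p + b * q + c * (1 - (p + q))) = 1 := by
  have he := (hp.add hq hpq).one_sub
  have hs := hp'.isSelfAdjoint.star_eq
  have hs' := hq'.isSelfAdjoint.star_eq
  have h2 := hp'.isIdempotentElem.eq
  have h3 := hq'.isIdempotentElem.eq
  have hqp' := hp'.mul_eq_zero_comm hq' hpq'
  have hce : (1 - (p' + q')) * c = c * (1 - (p + q)) := by rw [sub_mul, mul_sub, hcpq]; simp
  have key : ∀ {u f : A}, star u * u = 1 → IsStarProjection f → star (u * f) * (u * f) = f := by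
    intro u f hu hf
    rw [star_mul, hf.isSelfAdjoint.star_eq, mul_assoc, ← mul_assoc (star u), hu, one_mul,
      hf.isIdempotentElem.eq]
  have := star_add_three_mul (key ha hp) (key hb hq) (key hc he)
    (by rw [← hap, ← hbq, star_mul, hs, mul_assoc, ← mul_assoc p', hpq', zero_mul, mul_zero])
    (by
      rw [← hap, ← hce, star_mul, hs, mul_assoc, ← mul_assoc p', mul_sub, mul_add, h2, hpq']
      simp)
    (by
      rw [← hbq, ← hce, star_mul, hs', mul_assoc, ← mul_assoc q', mul_sub, mul_add, h3, hqp']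
      simp)
  rw [this]
  abel

/-- Gluing three unitaries along an orthogonal decomposition. -/
lemma glue_mem_unitary (hp : IsStarProjection p) (hq : IsStarProjection q)
    (hp' : IsStarProjection p') (hq' : IsStarProjection q') (hpq : p * q = 0)
    (hpq' : p' * q' = 0) (ha : a ∈ unitary A) (hb : b ∈ unitary A) (hc : c ∈ unitary A)
    (hap : p' * a = a * p) (hbq : q' * b = b * q) (hcpq : (p' + q') * c = c * (p + q)) :
    a * p + b * q + c * (1 - (p + q)) ∈ unitary A := by
  refine Unitary.mem_iff.mpr ⟨star_glue_mul_glue hp hq hp' hq' hpq hpq' (Unitary.mem_iff.mp ha).1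
    (Unitary.mem_iff.mp hb).1 (Unitary.mem_iff.mp hc).1 hap hbq hcpq, ?_⟩
  have hflip : ∀ {f f' u : A}, IsStarProjection f → IsStarProjection f' → f' * u = u * f →
      f * star u = star u * f' := by
    intro f f' u hf hf' h
    have := congrArg star h
    rw [star_mul, star_mul, hf.isSelfAdjoint.star_eq, hf'.isSelfAdjoint.star_eq] at this
    exact this.symm
  -- The adjoint of the glued element is the gluing of the adjoints with primed and unprimed
  -- projections exchanged, so the same identity gives the other half of unitarity.
  have h := star_glue_mul_glue (a := star a) (b := star b) (c := star c) hp' hq' hp hq hpq' hpq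
    (by simpa using (Unitary.mem_iff.mp ha).2) (by simpa using (Unitary.mem_iff.mp hb).2)
    (by simpa using (Unitary.mem_iff.mp hc).2) (hflip hp hp' hap) (hflip hq hq' hbq)
    (hflip (hp.add hq hpq) (hp'.add hq' hpq') hcpq)
  have e : star (a * p + b * q + c * (1 - (p + q)))
      = star a * p' + star b * q' + star c * (1 - (p' + q')) := by
    have hce : (1 - (p' + q')) * c = c * (1 - (p + q)) := by rw [sub_mul, mul_sub, hcpq]; simp
    rw [← hap, ← hbq, ← hce]
    simp [hp'.isSelfAdjoint.star_eq, hq'.isSelfAdjoint.star_eq]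
  rw [← e, star_star] at h
  exact h

lemma glue_intertwines (hp : IsStarProjection p) (hq : IsStarProjection q)
    (hp' : IsStarProjection p') (hq' : IsStarProjection q') (hpq : p * q = 0)
    (hpq' : p' * q' = 0) (hap : p' * a = a * p) (hbq : q' * b = b * q)
    (hcpq : (p' + q') * c = c * (p + q)) :
    (p' + q') * (a * p + b * q + c * (1 - (p + q)))
      = (a * p + b * q + c * (1 - (p + q))) * (p + q) := by
  have h1 := hp.isIdempotentElem.eq
  have h2 := hq.isIdempotentElem.eq
  have h3 := hp'.isIdempotentElem.eq
  have h4 := hq'.isIdempotentElem.eq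
  have hqp := hp.mul_eq_zero_comm hq hpq
  have hqp' := hp'.mul_eq_zero_comm hq' hpq'
  have e1 : (p' + q') * (a * p) = a * p := by
    rw [← hap, ← mul_assoc, add_mul, h3, hqp', add_zero]
  have e2 : (p' + q') * (b * q) = b * q := by
    rw [← hbq, ← mul_assoc, add_mul, h4, hpq', zero_add]
  have e3 : (p + q) * (1 - (p + q)) = 0 := (hp.add hq hpq).mul_one_sub_self
  have e4 : (1 - (p + q)) * (p + q) = 0 := (hp.add hq hpq).one_sub_mul_self
  rw [mul_add, mul_add, e1, e2, ← mul_assoc, hcpq, mul_assoc, e3, add_mul, mul_assoc c, e4, add_mul,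
    mul_assoc a, mul_assoc b, mul_add p, mul_add q, h1, h2, hpq, hqp]
  simp

end GluedUnitary

/-! ### Direct sums with quaternionic index order. -/

section SumIndex

/-- Regrouping of the index set of a quaternionic basis of a direct sum. -/
def sumIndexEquiv (n m : ℕ) :
    Fin (n + m) ⊕ Fin (n + m) ≃ (Fin n ⊕ Fin n) ⊕ (Fin m ⊕ Fin m) :=
  (Equiv.sumCongr finSumFinEquiv.symm finSumFinEquiv.symm).trans (Equiv.sumSumSumComm _ _ _ _)

/-- The direct sum of two matrices, with regrouped indices. -/
def directSum {n m : ℕ} (A : Matrix (Fin n ⊕ Fin n) (Fin n ⊕ Fin n) ℂ)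
    (B : Matrix (Fin m ⊕ Fin m) (Fin m ⊕ Fin m) ℂ) :
    Matrix (Fin (n + m) ⊕ Fin (n + m)) (Fin (n + m) ⊕ Fin (n + m)) ℂ :=
  (Matrix.fromBlocks A 0 0 B).submatrix (sumIndexEquiv n m) (sumIndexEquiv n m)

variable {n m : ℕ}

lemma directSum_mul (A A' : Matrix (Fin n ⊕ Fin n) (Fin n ⊕ Fin n) ℂ)
    (B B' : Matrix (Fin m ⊕ Fin m) (Fin m ⊕ Fin m) ℂ) :
    directSum A B * directSum A' B' = directSum (A * A') (B * B') := by
  rw [directSum, directSum, Matrix.submatrix_mul_equiv, Matrix.fromBlocks_multiply]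
  simp [directSum]

lemma directSum_transpose (A : Matrix (Fin n ⊕ Fin n) (Fin n ⊕ Fin n) ℂ)
    (B : Matrix (Fin m ⊕ Fin m) (Fin m ⊕ Fin m) ℂ) :
    (directSum A B).transpose = directSum A.transpose B.transpose := by
  simp [directSum, Matrix.transpose_submatrix, Matrix.fromBlocks_transpose]

lemma directSum_neg (A : Matrix (Fin n ⊕ Fin n) (Fin n ⊕ Fin n) ℂ)
    (B : Matrix (Fin m ⊕ Fin m) (Fin m ⊕ Fin m) ℂ) :
    directSum (-A) (-B) = -directSum A B := by
  have : Matrix.fromBlocks (-A) 0 0 (-B) = -Matrix.fromBlocks A 0 0 B := by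
    simp [Matrix.fromBlocks_neg]
  rw [directSum, this]
  rfl

lemma det_directSum (A : Matrix (Fin n ⊕ Fin n) (Fin n ⊕ Fin n) ℂ)
    (B : Matrix (Fin m ⊕ Fin m) (Fin m ⊕ Fin m) ℂ) :
    (directSum A B).det = A.det * B.det := by
  rw [directSum, Matrix.det_submatrix_equiv_self, Matrix.det_fromBlocks_zero₂₁]

lemma sumIndexEquiv_inl (i : Fin (n + m)) : sumIndexEquiv n m (Sum.inl i)
    = Sum.map Sum.inl Sum.inl (finSumFinEquiv.symm i) := by
  rcases h : (finSumFinEquiv.symm i : Fin n ⊕ Fin m) with j | j <;> simp [sumIndexEquiv, h]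

lemma sumIndexEquiv_inr (i : Fin (n + m)) : sumIndexEquiv n m (Sum.inr i)
    = Sum.map Sum.inr Sum.inr (finSumFinEquiv.symm i) := by
  rcases h : (finSumFinEquiv.symm i : Fin n ⊕ Fin m) with j | j <;> simp [sumIndexEquiv, h]

/-- The purpose of the regrouping: the order `u, v, Tu, Tv` keeps the structure matrix standard, so
factorizations add blockwise. -/
lemma directSum_quatJ : directSum (quatJ n) (quatJ m) = quatJ (n + m) := by
  ext i j
  rcases i with i | i <;> rcases j with j | j <;>
    obtain ⟨i, rfl⟩ := finSumFinEquiv.surjective i <;>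
    obtain ⟨j, rfl⟩ := finSumFinEquiv.surjective j <;>
    rcases i with i | i <;> rcases j with j | j <;>
    simp [directSum, quatJ, sumIndexEquiv_inl, sumIndexEquiv_inr, Matrix.one_apply,
      -finSumFinEquiv_apply_left, -finSumFinEquiv_apply_right]

lemma directSum_factorization {A A' : Matrix (Fin n ⊕ Fin n) (Fin n ⊕ Fin n) ℂ}
    {B B' : Matrix (Fin m ⊕ Fin m) (Fin m ⊕ Fin m) ℂ}
    (hA : A = quatJ n * A'.transpose * (quatJ n)⁻¹ * A')
    (hB : B = quatJ m * B'.transpose * (quatJ m)⁻¹ * B') :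
    directSum A B = quatJ (n + m) * (directSum A' B').transpose * (quatJ (n + m))⁻¹
      * directSum A' B' := by
  rw [quatJ_inv, ← directSum_quatJ, ← directSum_neg, directSum_transpose, directSum_mul,
    directSum_mul, directSum_mul, hA, hB, quatJ_inv, quatJ_inv]

lemma quatFamily_append {H : Type*} [NormedAddCommGroup H] [InnerProductSpace ℂ H]
    (T : H ≃ₗᵢ⋆[ℂ] H) (u : Fin n → H) (v : Fin m → H) :
    quatFamily T (fun i => Sum.elim u v (finSumFinEquiv.symm i))
      = Sum.elim (quatFamily T u) (quatFamily T v) ∘ sumIndexEquiv n m := by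
  ext j
  rcases j with i | i <;> obtain ⟨i, rfl⟩ := finSumFinEquiv.surjective i <;>
    rcases i with i | i <;>
    simp [quatFamily, sumIndexEquiv_inl, sumIndexEquiv_inr,
      -finSumFinEquiv_apply_left, -finSumFinEquiv_apply_right]

lemma famMul_directSum {H : Type*} [NormedAddCommGroup H] [InnerProductSpace ℂ H]
    (A : Matrix (Fin n ⊕ Fin n) (Fin n ⊕ Fin n) ℂ) (B : Matrix (Fin m ⊕ Fin m) (Fin m ⊕ Fin m) ℂ)
    (w : Fin n ⊕ Fin n → H) (v : Fin m ⊕ Fin m → H) :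
    famMul (directSum A B) (Sum.elim w v ∘ sumIndexEquiv n m)
      = Sum.elim (famMul A w) (famMul B v) ∘ sumIndexEquiv n m := by
  ext j
  simp only [famMul_apply, directSum, Matrix.submatrix_apply, Function.comp_apply]
  rw [Equiv.sum_comp (sumIndexEquiv n m)
    (fun a => Matrix.fromBlocks A 0 0 B (sumIndexEquiv n m j) a • Sum.elim w v a)]
  rcases sumIndexEquiv n m j with i | i <;> simp [famMul_apply, Fintype.sum_sum_type]

end SumIndex

/-! ### The sum of two projection-valued maps, and its index. -/

section Sum

variable {H : Type*} [NormedAddCommGroup H] [InnerProductSpace ℂ H]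

lemma range_add_of_comp_eq_zero {p q : H →L[ℂ] H} (hp : IsIdempotentElem p)
    (hq : IsIdempotentElem q) (hpq : p * q = 0) (hqp : q * p = 0) :
    LinearMap.range ((p + q : H →L[ℂ] H) : H →ₗ[ℂ] H)
      = LinearMap.range (p : H →ₗ[ℂ] H) ⊔ LinearMap.range (q : H →ₗ[ℂ] H) := by
  apply le_antisymm
  · rintro _ ⟨x, rfl⟩
    exact Submodule.add_mem_sup ⟨x, rfl⟩ ⟨x, rfl⟩
  · refine sup_le ?_ ?_
    · rintro _ ⟨x, rfl⟩
      have : (p + q) * p = p := by rw [add_mul, hp.eq, hqp, add_zero]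
      exact ⟨p x, congrArg (fun A : H →L[ℂ] H => A x) this⟩
    · rintro _ ⟨x, rfl⟩
      have : (p + q) * q = q := by rw [add_mul, hq.eq, hpq, zero_add]
      exact ⟨q x, congrArg (fun A : H →L[ℂ] H => A x) this⟩

lemma range_inf_range_eq_bot {p q : H →L[ℂ] H} (hp : IsIdempotentElem p) (hpq : p * q = 0) :
    LinearMap.range (p : H →ₗ[ℂ] H) ⊓ LinearMap.range (q : H →ₗ[ℂ] H) = ⊥ := by
  rw [eq_bot_iff]
  rintro y ⟨⟨x, hx⟩, ⟨z, hz⟩⟩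
  have h1 : p (p x) = p x := congrArg (fun A : H →L[ℂ] H => A x) hp.eq
  have h2 : p (q z) = 0 := congrArg (fun A : H →L[ℂ] H => A z) hpq
  have hx' : p x = y := hx
  have hz' : q z = y := hz
  rw [hx'] at h1
  rw [hz', h1] at h2
  exact h2

lemma range_apply_eq_self {p : H →L[ℂ] H} (hp : IsIdempotentElem p) {y : H}
    (hy : y ∈ LinearMap.range (p : H →ₗ[ℂ] H)) : p y = y := by
  obtain ⟨x, rfl⟩ := hy
  exact congrArg (fun A : H →L[ℂ] H => A x) hp.eq

variable [CompleteSpace H]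
variable {T : H ≃ₗᵢ⋆[ℂ] H} {P Q : Torus2 → H →L[ℂ] H} {n m r s : ℕ}

lemma IsTRSProjMap.add (hP : IsTRSProjMap T r P) (hQ : IsTRSProjMap T s Q)
    (hPQ : ∀ k, P k * Q k = 0) : IsTRSProjMap T (r + s) (P + Q) where
  continuous := hP.continuous.add hQ.continuous
  proj k := (hP.proj k).add (hQ.proj k) (hPQ k)
  rank k := by
    rw [Pi.add_apply, range_add_of_comp_eq_zero (hP.proj k).isIdempotentElem
      (hQ.proj k).isIdempotentElem (hPQ k) ((hP.proj k).mul_eq_zero_comm (hQ.proj k) (hPQ k))]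
    have := Submodule.rank_sup_add_rank_inf_eq (LinearMap.range (P k : H →ₗ[ℂ] H))
      (LinearMap.range (Q k : H →ₗ[ℂ] H))
    rw [range_inf_range_eq_bot (hP.proj k).isIdempotentElem (hPQ k), rank_bot, add_zero,
      hP.rank, hQ.rank] at this
    rw [this, Nat.cast_add]
  symm k x := by
    simp only [Pi.add_apply, add_apply, map_add, hP.symm, hQ.symm]

/-- The direct sum of the choices for `P` and `Q` gives choices for `P + Q`. -/
lemma exists_parityData_add (hT : IsFermionicTR T) (hP : IsTRSProjMap T r P)
    (hQ : IsTRSProjMap T s Q) (hPQ : ∀ k, P k * Q k = 0) (D : ParityData T P n)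
    (E : ParityData T Q m) : ∃ F : ParityData T (P + Q) (n + m), F.value = D.value * E.value := by
  have hR := hP.add hQ hPQ
  obtain ⟨U, hUc, hUP, hUT⟩ := hR.exists_unitary hT
  let clamp : ℝ → ℝ := fun t => max (-π) (min π t)
  have hclamp : ∀ t : ℝ, clamp t ∈ Set.Icc (-π) π := fun t =>
    ⟨le_max_left _ _, max_le (by linarith [Real.pi_pos]) (min_le_left _ _)⟩
  have hclamp' : ∀ t ∈ Set.Icc (-π) π, clamp t = t := fun t ht => by
    simp only [clamp]
    rw [min_eq_right ht.2, max_eq_right ht.1]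
  -- The given unitaries are used on the ranges of `P (0, 0)` and `Q (0, 0)`. On the complement a
  -- trivialisation of `P + Q` is used, since it intertwines the complementary projections too.
  let G : ℝ → Circ → H →L[ℂ] H := fun t k => D.U t k * P (0, 0) + E.U t k * Q (0, 0)
    + U t k * (1 - (P (0, 0) + Q (0, 0)))
  have hGu : ∀ t ∈ Set.Icc (-π) π, ∀ k, G t k ∈ unitary (H →L[ℂ] H) := fun t ht k =>
    glue_mem_unitary (hP.proj _) (hQ.proj _) (hP.proj ((t : Circ), k)) (hQ.proj _) (hPQ _) (hPQ _)
      (D.U t k).2 (E.U t k).2 (U t k).2 (D.U_intertwines t ht k) (E.U_intertwines t ht k)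
      (hUP t ht k)
  have hGi : ∀ t ∈ Set.Icc (-π) π, ∀ k : Circ,
      (P + Q) ((t : Circ), k) * G t k = G t k * (P + Q) (0, 0) := fun t ht k =>
    glue_intertwines (hP.proj _) (hQ.proj _) (hP.proj ((t : Circ), k)) (hQ.proj _) (hPQ _) (hPQ _)
      (D.U_intertwines t ht k) (E.U_intertwines t ht k) (hUP t ht k)
  -- `G` is known to be unitary only for `t ∈ [-π, π]`; clamping makes `V` total.
  let V : ℝ → Circ → unitary (H →L[ℂ] H) := fun t k => ⟨G (clamp t) k, hGu _ (hclamp t) k⟩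
  have hV : ∀ t ∈ Set.Icc (-π) π, ∀ k, (V t k : H →L[ℂ] H) = G t k := fun t ht k => by
    simp only [V, hclamp' t ht]
  have hVc : ContinuousOn (fun p : ℝ × Circ => V p.1 p.2) (Set.Icc (-π) π ×ˢ Set.univ) := by
    rw [Topology.IsInducing.subtypeVal.continuousOn_iff]
    have hG : ContinuousOn (fun p : ℝ × Circ => G p.1 p.2) (Set.Icc (-π) π ×ˢ Set.univ) := by
      have h1 := continuous_subtype_val.comp_continuousOn D.U_cont
      have h2 := continuous_subtype_val.comp_continuousOn E.U_cont
      have h3 := (continuous_subtype_val.comp hUc).continuousOn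
        (s := Set.Icc (-π) π ×ˢ (Set.univ : Set Circ))
      exact ((h1.mul continuousOn_const).add (h2.mul continuousOn_const)).add
        (h3.mul continuousOn_const)
    exact hG.congr fun p hp => hV p.1 hp.1 p.2
  have hPT : ∀ x, T (P (0, 0) x) = P (0, 0) (T x) := fun x => by
    simpa using hP.symm (0, 0) x
  have hQT : ∀ x, T (Q (0, 0) x) = Q (0, 0) (T x) := fun x => by
    simpa using hQ.symm (0, 0) x
  have hUT' : ∀ t (k : Circ) (x : H),
      T ((U t k : H →L[ℂ] H) x) = (U (-t) (-k) : H →L[ℂ] H) (T x) := by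
    intro t k x
    rw [hUT, coe_trConjUnitary, trConj_apply_map]
  have hVT : ∀ t ∈ Set.Icc (-π) π, ∀ (k : Circ) (x : H),
      T ((V t k : H →L[ℂ] H) x) = (V (-t) (-k) : H →L[ℂ] H) (T x) := by
    intro t ht k x
    rw [hV t ht, hV _ (neg_mem_Icc_pi ht)]
    simp only [G, add_apply, mul_apply_eq_comp, map_add,
      sub_apply, one_apply_eq_self, map_sub,
      D.U_symm t ht, E.U_symm t ht, hUT', hPT, hQT]
  have hDu : ∀ j, quatFamily T D.u j ∈ LinearMap.range (P (0, 0) : H →ₗ[ℂ] H) := fun j => by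
    rw [← D.u_span]; exact Submodule.subset_span ⟨j, rfl⟩
  have hEu : ∀ j, quatFamily T E.u j ∈ LinearMap.range (Q (0, 0) : H →ₗ[ℂ] H) := fun j => by
    rw [← E.u_span]; exact Submodule.subset_span ⟨j, rfl⟩
  have hP1 := fun j => range_apply_eq_self (hP.proj _).isIdempotentElem (hDu j)
  have hQ1 := fun j => range_apply_eq_self (hQ.proj _).isIdempotentElem (hEu j)
  have hPQ0 : ∀ x, P (0, 0) (Q (0, 0) x) = 0 := fun x =>
    congrArg (fun A : H →L[ℂ] H => A x) (hPQ (0, 0))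
  have hQP0 : ∀ x, Q (0, 0) (P (0, 0) x) = 0 := fun x =>
    congrArg (fun A : H →L[ℂ] H => A x)
      ((hP.proj (0, 0)).mul_eq_zero_comm (hQ.proj (0, 0)) (hPQ (0, 0)))
  have hQD : ∀ j, Q (0, 0) (quatFamily T D.u j) = 0 := fun j => by rw [← hP1 j, hQP0]
  have hPE : ∀ j, P (0, 0) (quatFamily T E.u j) = 0 := fun j => by rw [← hQ1 j, hPQ0]
  let u : Fin (n + m) → H := fun i => Sum.elim D.u E.u (finSumFinEquiv.symm i)
  have hu : quatFamily T u = Sum.elim (quatFamily T D.u) (quatFamily T E.u) ∘ sumIndexEquiv n m :=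
    quatFamily_append T D.u E.u
  have hframe : ∀ t ∈ Set.Icc (-π) π, ∀ k, (fun j => (V t k : H →L[ℂ] H) (quatFamily T u j))
      = Sum.elim (D.frame t k) (E.frame t k) ∘ sumIndexEquiv n m := by
    intro t ht k
    ext j
    rw [hV t ht, hu]
    simp only [Function.comp_apply]
    rcases sumIndexEquiv n m j with i | i <;>
      simp [G, hP1, hQ1, hQD, hPE, ParityData.frame]
  refine ⟨{ U := V, U_cont := hVc, U_intertwines := ?_, U_symm := hVT, u := u,
            u_orthonormal := ?_, u_span := ?_, α := fun k => directSum (D.α k) (E.α k),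
            α_matching := ?_, γ₀ := directSum D.γ₀ E.γ₀, γπ := directSum D.γπ E.γπ,
            γ₀_spec := directSum_factorization D.γ₀_spec E.γ₀_spec,
            γπ_spec := directSum_factorization D.γπ_spec E.γπ_spec,
            l₀ := D.l₀ + E.l₀, lπ := D.lπ + E.lπ, l₀_spec := ?_, lπ_spec := ?_,
            μ := fun k => D.μ k + E.μ k, μ_cont := D.μ_cont.add E.μ_cont, μ_spec := ?_,
            μ_zero := ?_ }, ?_⟩
  · intro t ht k
    rw [hV t ht]
    exact hGi t ht k
  · rw [hu]
    refine Orthonormal.comp ?_ _ (sumIndexEquiv n m).injective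
    have hPE' : ∀ i j, inner ℂ (quatFamily T D.u i) (quatFamily T E.u j) = 0 := fun i j => by
      rw [← hP1 i, ← (hP.proj (0, 0)).isSelfAdjoint.star_eq,
        ContinuousLinearMap.star_eq_adjoint, ContinuousLinearMap.adjoint_inner_left, hPE,
        inner_zero_right]
    have h1 := orthonormal_iff_ite.mp D.u_orthonormal
    have h2 := orthonormal_iff_ite.mp E.u_orthonormal
    rw [orthonormal_iff_ite]
    rintro (i | i) (j | j)
    · simpa using h1 i j
    · simpa using hPE' i j
    · simp only [Sum.elim_inr, Sum.elim_inl, reduceCtorEq, if_false]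
      rw [← inner_conj_symm, hPE', map_zero]
    · simpa using h2 i j
  · rw [hu, (sumIndexEquiv n m).surjective.range_comp, Set.Sum.elim_range, Submodule.span_union,
      D.u_span, E.u_span]
    exact (range_add_of_comp_eq_zero (hP.proj _).isIdempotentElem (hQ.proj _).isIdempotentElem
      (hPQ _) ((hP.proj _).mul_eq_zero_comm (hQ.proj _) (hPQ _))).symm
  · intro k j
    have h1 := hframe _ (neg_mem_Icc_pi pi_mem_Icc_pi) k
    have h2 := hframe _ pi_mem_Icc_pi k
    have hD : famMul (D.α k) (D.frame π k) = D.frame (-π) k :=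
      funext fun j => (D.α_matching k j).symm
    have hE : famMul (E.α k) (E.frame π k) = E.frame (-π) k :=
      funext fun j => (E.α_matching k j).symm
    have h3 := famMul_directSum (D.α k) (E.α k) (D.frame π k) (E.frame π k)
    rw [hD, hE, ← h1, ← h2] at h3
    exact (congrFun h3 j).symm
  · rw [det_directSum, D.l₀_spec, E.l₀_spec, ← Complex.exp_add]
    push_cast
    rw [mul_add]
  · rw [det_directSum, D.lπ_spec, E.lπ_spec, ← Complex.exp_add]
    push_cast
    rw [mul_add]
  · intro k hk
    rw [det_directSum, D.μ_spec k hk, E.μ_spec k hk, ← Complex.exp_add]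
    push_cast
    rw [mul_add]
  · rw [D.μ_zero, E.μ_zero, mul_add]
  · simp only [ParityData.value]
    rw [← Complex.exp_add]
    congr 1
    push_cast
    ring

lemma IsParityIndex.unique (hT : IsFermionicTR T) (hP : IsTRSProjMap T r P) {z z' : ℂ}
    (hz : IsParityIndex T P z) (hz' : IsParityIndex T P z') : z' = z := by
  obtain ⟨a, D, rfl⟩ := hz
  obtain ⟨b, D', rfl⟩ := hz'
  obtain rfl : a = b := by
    have h1 := D.two_mul_eq hP
    have h2 := D'.two_mul_eq hP
    omega
  exact D.value_eq hT D'

lemma existsUnique_isParityIndex (hT : IsFermionicTR T) (hP : IsTRSProjMap T (2 * n) P) :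
    ∃! z : ℂ, IsParityIndex T P z := by
  obtain ⟨D⟩ := nonempty_parityData hT hP
  exact ⟨D.value, ⟨n, D, rfl⟩, fun z hz => IsParityIndex.unique hT hP ⟨n, D, rfl⟩ hz⟩

/-- `Classical.epsilon` returns some admissible value, and uniqueness identifies it with that of any
given choices. -/
lemma ParityData.parityIndex_eq (hT : IsFermionicTR T) (hP : IsTRSProjMap T r P)
    (D : ParityData T P n) : parityIndex T P = D.value :=
  IsParityIndex.unique hT hP ⟨n, D, rfl⟩ (Classical.epsilon_spec ⟨D.value, n, D, rfl⟩)

lemma parityIndex_eq_one_or (hT : IsFermionicTR T) (hP : IsTRSProjMap T (2 * n) P) :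
    parityIndex T P = 1 ∨ parityIndex T P = -1 := by
  obtain ⟨D⟩ := nonempty_parityData hT hP
  rw [D.parityIndex_eq hT hP]
  exact sq_eq_one_iff.mp D.value_sq

end Sum

end

/-- The index `δ` is well defined (independent of all choices) on `P`, `Q` and `P + Q`, takes
values in `{1, -1}`, and is multiplicative: `δ(P + Q) = δ(P) δ(Q)`. -/
theorem mainTheorem5 {H : Type*} [NormedAddCommGroup H] [InnerProductSpace ℂ H] [CompleteSpace H]
    (T : H ≃ₗᵢ⋆[ℂ] H) (hT : IsFermionicTR T) (n m : ℕ) (P Q : Torus2 → H →L[ℂ] H)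
    (hP : IsTRSProjMap T (2 * n) P) (hQ : IsTRSProjMap T (2 * m) Q)
    (hPQ : ∀ k, P k ∘L Q k = 0) :
    IsTRSProjMap T (2 * (n + m)) (P + Q) ∧
    (∃! z : ℂ, IsParityIndex T P z) ∧
    (∃! z : ℂ, IsParityIndex T Q z) ∧
    (∃! z : ℂ, IsParityIndex T (P + Q) z) ∧
    (parityIndex T P = 1 ∨ parityIndex T P = -1) ∧
    (parityIndex T Q = 1 ∨ parityIndex T Q = -1) ∧
    parityIndex T (P + Q) = parityIndex T P * parityIndex T Q := by
  have hPQ' : ∀ k, P k * Q k = 0 := hPQ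
  have hR : IsTRSProjMap T (2 * (n + m)) (P + Q) := by
    rw [mul_add]
    exact hP.add hQ hPQ'
  refine ⟨hR, existsUnique_isParityIndex hT hP, existsUnique_isParityIndex hT hQ,
    existsUnique_isParityIndex hT hR, parityIndex_eq_one_or hT hP, parityIndex_eq_one_or hT hQ, ?_⟩
  obtain ⟨D⟩ := nonempty_parityData hT hP
  obtain ⟨E⟩ := nonempty_parityData hT hQ
  obtain ⟨F, hF⟩ := exists_parityData_add hT hP hQ hPQ' D E
  rw [D.parityIndex_eq hT hP, E.parityIndex_eq hT hQ, F.parityIndex_eq hT hR, hF]
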